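/- Let $\tau>0$. On $\mathbb R^4$ let $\langle v,w\rangle=v_1w_1+v_2w_2-v_3w_3-v_4w_4$, and identify $\mathrm{SL}(2,\mathbb R)$ with $\{v\in\mathbb R^4:\langle v,v\rangle=1\}=\{(z,w)\in\mathbb C^2:|z|^2-|w|^2=1\}$, where $z=v_1+iv_2$, $w=v_3+iv_4$. Let $X_1(z,w)=(iz,iw)$, $X_2(z,w)=(i\bar w,i\bar z)$, $X_3(z,w)=(\bar w,\bar z)$, let $g_\tau(X,Y)=-\langle X,Y\rangle+(1+\tau^2)\langle X,X_1\rangle\langle Y,X_1\rangle$ be the Riemannian metric on $\mathrm{SL}(2,\mathbb R)$ for which $E_1=-\tau^{-1}X_1$, $E_2=X_2$, $E_3=X_3$ is an orthonormal frame, and let $\nabla$ be its Levi-Civita connection and $R(X,Y)Z=\nabla_X\nabla_YZ-\nabla_Y\nabla_XZ-\nabla_{[X,Y]}Z$ its curvature. A smooth curve $\gamma:I\to(\mathrm{SL}(2,\mathbb R),g_\tau)$ on an open interval $I$, parametrized by arc length, with $T=\gamma'$, is called biharmonic if its bitension field $\nabla_T\nabla_T\nabla_TT-R(T,\nabla_TT)T$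 vanishes, and proper biharmonic if moreover it is not a geodesic (that is, $\nabla_TT\not\equiv0$). Theorem. Let $\gamma:I\to(\mathrm{SL}(2,\mathbb R),g_\tau)$ be a proper biharmonic curve parametrized by arc length, oriented so that $g_\tau(\gamma',E_1)\ge 0$. Then there are a constant $\vartheta\in(0,\pi/2]$ and a smooth function $\beta:I\to\mathbb R$ with constant derivative $b=\beta'$ such that $$\gamma'=\cos\vartheta\,E_1+\sin\vartheta\sin\beta\,E_2+\sin\vartheta\cos\beta\,E_3 .$$ For any such $\vartheta$, $\beta$, $b$, put $$a=\tfrac12\big(-\tau^{-2}+1-(1+\tau^{-2})\cos2\vartheta\big)-\tau^{-1}\cos\vartheta\; b .$$ If $b^2=4a$, then $$b=-\tau^{-1}(2+\tau^2)\cos\vartheta+\sqrt{(4+5\tau^2)\cos^2\vartheta-4(1+\tau^2)},\qquad \cos^2\vartheta=\frac{(2+\tau^2)^2}{4+5\tau^2+\tau^4},$$ and there is a matrix $A\in\mathrm O_2(4)=\{A\in\mathrm{GL}(4,\mathbb R):A^t=\epsilon A^{-1}\epsilon\}$, $\epsilon=\mathrm{diag}(1,1,-1,-1)$, with $AJ_1=J_1A$,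 where $J_1(z,w)=(iz,iw)$, such that for all $s\in I$ $$\gamma(s)=A\big(\cos(\sqrt a\,s)+g_{14}\,s\sin(\sqrt a\,s),\;-\sin(\sqrt a\,s)+g_{14}\,s\cos(\sqrt a\,s),\;-g_{14}\,s\cos(\sqrt a\,s),\;g_{14}\,s\sin(\sqrt a\,s)\big),$$ where $g_{14}=\dfrac{\tau}{\sqrt{4+5\tau^2+\tau^4}}$. -/

import Mathlib

open scoped ContDiff Matrix

noncomputable section

namespace SLtau

/-- The underlying vector space of the pseudo-Euclidean space `ℝ⁴₂`. A point `v` stands for the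
pair `(z, w) = (v 0 + i v 1, v 2 + i v 3)` in `ℂ²`. -/
abbrev R42 : Type := Fin 4 → ℝ

/-- The inner product of signature `(2, 2)`. -/
def pinner (v w : R42) : ℝ := v 0 * w 0 + v 1 * w 1 - v 2 * w 2 - v 3 * w 3

/-- `SL(2, ℝ)` as the pseudo-sphere `⟨v, v⟩ = 1`, that is `|z|² - |w|² = 1`. -/
def SL2 : Set R42 := {v | pinner v v = 1}

/-- `X₁ (z, w) = (i z, i w)`, the (unnormalised) Hopf vector field. -/
def X1 (v : R42) : R42 := ![-v 1, v 0, -v 3, v 2]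

/-- `X₂ (z, w) = (i w̄, i z̄)`. -/
def X2 (v : R42) : R42 := ![v 3, v 2, v 1, v 0]

/-- `X₃ (z, w) = (w̄, z̄)`. -/
def X3 (v : R42) : R42 := ![v 2, -v 3, v 0, -v 1]

/-- The metric `g_τ` at the point `p`, on vectors `x`, `y` tangent to `SL(2, ℝ)` at `p`. -/
def metric (τ : ℝ) (p x y : R42) : ℝ :=
  -pinner x y + (1 + τ ^ 2) * pinner x (X1 p) * pinner y (X1 p)

/-- The `g_τ`-orthonormal frame `E₁ = -τ⁻¹ X₁`, `E₂ = X₂`, `E₃ = X₃`, indexed by `0, 1, 2`. -/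
def frame (τ : ℝ) (i : Fin 3) (p : R42) : R42 :=
  match i with
  | 0 => (-τ⁻¹) • X1 p
  | 1 => X2 p
  | 2 => X3 p

/-- The Koszul expression for `g_τ(∇_X Y, Z)`. Vector fields on `SL(2, ℝ)` are represented by
vector fields on the ambient space that are tangent to `SL(2, ℝ)` along it; only their values
on `SL(2, ℝ)` matter at points of `SL(2, ℝ)`. -/
def koszul (τ : ℝ) (X Y Z : R42 → R42) (p : R42) : ℝ :=
  (1 / 2) *
    (fderiv ℝ (fun q => metric τ q (Y q) (Z q)) p (X p)
      + fderiv ℝ (fun q => metric τ q (X q) (Z q)) p (Y p)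
      - fderiv ℝ (fun q => metric τ q (X q) (Y q)) p (Z p)
      + metric τ p (VectorField.lieBracket ℝ X Y p) (Z p)
      - metric τ p (VectorField.lieBracket ℝ X Z p) (Y p)
      - metric τ p (VectorField.lieBracket ℝ Y Z p) (X p))

/-- The Levi-Civita connection `∇_X Y` of `g_τ`, expanded in the orthonormal frame. -/
def nabla (τ : ℝ) (X Y : R42 → R42) (p : R42) : R42 :=
  ∑ k : Fin 3, koszul τ X Y (frame τ k) p • frame τ k p

/-- `R(X, Y) Z = ∇_X ∇_Y Z - ∇_Y ∇_X Z - ∇_[X, Y] Z` on vector fields. -/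
def curvField (τ : ℝ) (X Y Z : R42 → R42) (p : R42) : R42 :=
  nabla τ X (nabla τ Y Z) p - nabla τ Y (nabla τ X Z) p
    - nabla τ (VectorField.lieBracket ℝ X Y) Z p

/-- The extension of a tangent vector `x` at `p` to the vector field that has the same
coefficients in the frame everywhere. -/
def extend (τ : ℝ) (p x : R42) (q : R42) : R42 :=
  ∑ i : Fin 3, metric τ p x (frame τ i p) • frame τ i q

/-- The curvature tensor `R(x, y) z` at `p`, on tangent vectors. -/
def curv (τ : ℝ) (p x y z : R42) : R42 :=
  curvField τ (extend τ p x) (extend τ p y) (extend τ p z) p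

/-- The covariant derivative along the curve `γ` of the vector field `V = ∑ⱼ Vⱼ Eⱼ` along `γ`:
`∑ⱼ (Vⱼ' Eⱼ + Vⱼ ∇_{γ'} Eⱼ)`, with `Vⱼ = g_τ(V, Eⱼ)`. -/
def covDeriv (τ : ℝ) (γ V : ℝ → R42) (s : ℝ) : R42 :=
  ∑ j : Fin 3,
    (deriv (fun t => metric τ (γ t) (V t) (frame τ j (γ t))) s • frame τ j (γ s)
      + metric τ (γ s) (V s) (frame τ j (γ s)) •
          nabla τ (extend τ (γ s) (deriv γ s)) (frame τ j) (γ s))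

/-- The tension field `∇_T T` of the curve `γ`, where `T = γ'`. -/
def tension (τ : ℝ) (γ : ℝ → R42) : ℝ → R42 :=
  covDeriv τ γ (deriv γ)

/-- The bitension field `∇_T ∇_T (∇_T T) - R(T, ∇_T T) T` of the curve `γ`, where `T = γ'`. -/
def bitension (τ : ℝ) (γ : ℝ → R42) (s : ℝ) : R42 :=
  covDeriv τ γ (covDeriv τ γ (tension τ γ)) s
    - curv τ (γ s) (deriv γ s) (tension τ γ s) (deriv γ s)

/-- `γ : I → SL(2, ℝ)_τ` is a smooth curve parametrized by arc length. -/
structure IsUnitSpeedCurve (τ : ℝ) (I : Set ℝ) (γ : ℝ → R42) : Prop where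
  smooth : ContDiffOn ℝ ∞ γ I
  mem : ∀ s ∈ I, γ s ∈ SL2
  unit_speed : ∀ s ∈ I, metric τ (γ s) (deriv γ s) (deriv γ s) = 1

/-- `γ` is proper biharmonic on `I`: its bitension field vanishes, and it is not a geodesic. -/
structure IsProperBiharmonic (τ : ℝ) (I : Set ℝ) (γ : ℝ → R42) : Prop where
  biharmonic : ∀ s ∈ I, bitension τ γ s = 0
  not_geodesic : ¬ ∀ s ∈ I, tension τ γ s = 0

/-- The data `ϑ`, `β`, `b` of a curve that makes the constant angle `ϑ ∈ (0, π/2]` with `E₁`: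
`γ' = cos ϑ E₁ + sin ϑ sin β E₂ + sin ϑ cos β E₃`, where `β` is smooth and `β' = b` is constant.
The representation of `γ'` determines `ϑ` and `b`, and `β` up to a multiple of `2π`. -/
structure HasAngleData (τ : ℝ) (I : Set ℝ) (γ : ℝ → R42) (ϑ : ℝ) (β : ℝ → ℝ) (b : ℝ) :
    Prop where
  angle_mem : ϑ ∈ Set.Ioc 0 (Real.pi / 2)
  smooth : ContDiffOn ℝ ∞ β I
  tangent : ∀ s ∈ I, deriv γ s =
    Real.cos ϑ • frame τ 0 (γ s)
      + (Real.sin ϑ * Real.sin (β s)) • frame τ 1 (γ s)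
      + (Real.sin ϑ * Real.cos (β s)) • frame τ 2 (γ s)
  hasDerivAt : ∀ s ∈ I, HasDerivAt β b s

/-- The constant `a`, in terms of `τ`, `ϑ` and `b = β'`. -/
def aConst (τ ϑ b : ℝ) : ℝ :=
  (1 / 2) * (-(τ ^ 2)⁻¹ + 1 - (1 + (τ ^ 2)⁻¹) * Real.cos (2 * ϑ)) - τ⁻¹ * Real.cos ϑ * b

/-- The complex structure `J₁ = diag(J, J)` of `ℝ⁴`. -/
def J1 : Matrix (Fin 4) (Fin 4) ℝ :=
  !![0, -1, 0, 0;
     1, 0, 0, 0;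
     0, 0, 0, -1;
     0, 0, 1, 0]

/-- `ε = diag(1, 1, -1, -1)`. -/
def eps : Matrix (Fin 4) (Fin 4) ℝ := Matrix.diagonal ![1, 1, -1, -1]

/-- The indefinite orthogonal group `O₂(4) = {A ∈ GL(4, ℝ) : Aᵗ = ε A⁻¹ ε}`, as a set. -/
def O24 : Set (Matrix (Fin 4) (Fin 4) ℝ) :=
  {A | IsUnit A ∧ Aᵀ = eps * A⁻¹ * eps}

/-- The constant `g₁₄`. -/
def g14 (τ : ℝ) : ℝ := τ / Real.sqrt (4 + 5 * τ ^ 2 + τ ^ 4)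

/-- The model curve `(cos(r s) + g s sin(r s), -sin(r s) + g s cos(r s), -g s cos(r s),
g s sin(r s))`. -/
def modelCurve (r g s : ℝ) : R42 :=
  ![Real.cos (r * s) + g * s * Real.sin (r * s),
    -Real.sin (r * s) + g * s * Real.cos (r * s),
    -(g * s * Real.cos (r * s)),
    g * s * Real.sin (r * s)]

end SLtau

end

/-! The frame is left-invariant, so in frame coefficients the connection and the curvature are fixed
algebraic expressions (`kosz_one`, `curvCoef_eq`), and the biharmonic equation becomes an ODE system
for the coefficients of T, V = ∇_T T and U = ∇_T V (`frameSystem`). Its tangential part gives V·U =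
0, so |V|² is constant. The normal and binormal parts then force the vertical component of V to
vanish (`FrameSystem.V_zero`). Hence T keeps a constant angle with E₁, and its horizontal part turns
with a constant speed b (`FrameSystem.exists_rotation`).

Substituting such a T into the normal part leaves one quadratic relation between b and ϑ
(`HasAngleData.speed_quadratic`). Together with b² = 4a it determines everything: sin ϑ = g₁₄ and b
= -2√a (`scalars_of_sq_eq`).

The curve now solves a linear ODE with known coefficients, and the model curve solves the same one
up to the phase of β. Multiplication by e^{iψ} on ℂ² shifts that phase by 2ψ, and two curves with
equal velocity coefficients differ by an element of SU(1,1) (`exists_suMat`). Both maps preserve the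
form and commute with J₁, so their composite is the required A (`exists_congruence`). -/

noncomputable section

namespace SLtau

/-! ### Brackets, connection and curvature in frame coefficients -/

/-- The quadratic form of `ℝ⁴₂`. -/
def quad (q : R42) : ℝ := pinner q q

/-- The vector at `q` with coefficients `a` in the frame. -/
def frameComb (τ : ℝ) (a : Fin 3 → ℝ) (q : R42) : R42 := ∑ i : Fin 3, a i • frame τ i q

/-- The Gram form of the frame at the points of the level `quad = n`. -/
def gram (τ n : ℝ) (a b : Fin 3 → ℝ) : ℝ :=
  τ⁻¹ ^ 2 * (-n + (1 + τ ^ 2) * n ^ 2) * (a 0 * b 0) + n * (a 1 * b 1 + a 2 * b 2)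

/-- The Lie bracket in frame coefficients. -/
def br (τ : ℝ) (a b : Fin 3 → ℝ) : Fin 3 → ℝ :=
  ![2 * τ * (a 1 * b 2 - a 2 * b 1), 2 * τ⁻¹ * (a 0 * b 2 - a 2 * b 0),
    -(2 * τ⁻¹ * (a 0 * b 1 - a 1 * b 0))]

/-- The Koszul expression in frame coefficients. -/
def kosz (τ n : ℝ) (a b c : Fin 3 → ℝ) : ℝ :=
  (1 / 2) * (gram τ n (br τ a b) c - gram τ n (br τ a c) b - gram τ n (br τ b c) a)

/-- The Levi-Civita connection in frame coefficients. -/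
def conn (τ : ℝ) (a b : Fin 3 → ℝ) : Fin 3 → ℝ :=
  ![τ * (a 1 * b 2 - a 2 * b 1), (2 * τ⁻¹ + τ) * a 0 * b 2 + τ * a 2 * b 0,
    -((2 * τ⁻¹ + τ) * a 0 * b 1) - τ * a 1 * b 0]

lemma frameComb_apply (τ : ℝ) (a : Fin 3 → ℝ) (q : R42) :
    frameComb τ a q = ![τ⁻¹ * a 0 * q 1 + a 1 * q 3 + a 2 * q 2,
      -(τ⁻¹ * a 0 * q 0) + a 1 * q 2 - a 2 * q 3,
      τ⁻¹ * a 0 * q 3 + a 1 * q 1 + a 2 * q 0,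
      -(τ⁻¹ * a 0 * q 2) + a 1 * q 0 - a 2 * q 1] := by
  ext i
  fin_cases i <;> simp [frameComb, frame, Fin.sum_univ_three, X1, X2, X3] <;> ring

lemma metric_frameComb (τ : ℝ) (a b : Fin 3 → ℝ) (q : R42) :
    metric τ q (frameComb τ a q) (frameComb τ b q) = gram τ (quad q) a b := by
  simp [frameComb_apply, metric, pinner, gram, quad, X1]
  ring

lemma frame_eq_frameComb (τ : ℝ) (i : Fin 3) : frame τ i = frameComb τ (Pi.single i 1) := by
  funext q
  simp [frameComb, Pi.single_apply]

lemma frameComb_add (τ : ℝ) (a b : Fin 3 → ℝ) (q : R42) :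
    frameComb τ (a + b) q = frameComb τ a q + frameComb τ b q := by
  simp [frameComb, add_smul, Finset.sum_add_distrib]

lemma frameComb_sub (τ : ℝ) (a b : Fin 3 → ℝ) (q : R42) :
    frameComb τ (a - b) q = frameComb τ a q - frameComb τ b q := by
  simp [frameComb, sub_smul, Finset.sum_sub_distrib]

lemma pinner_frameComb (τ : ℝ) (a : Fin 3 → ℝ) (q : R42) : pinner q (frameComb τ a q) = 0 := by
  simp [frameComb_apply, pinner]
  ring

/-- The frame fields are linear in q and span a Lie algebra isomorphic to sl(2, ℝ), so their bracket
is a commutator of linear maps. -/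
lemma frameComb_comm {τ : ℝ} (hτ : τ ≠ 0) (a b : Fin 3 → ℝ) (q : R42) :
    frameComb τ b (frameComb τ a q) - frameComb τ a (frameComb τ b q)
      = frameComb τ (br τ a b) q := by
  ext i
  fin_cases i <;> simp [frameComb_apply, br] <;> field_simp <;> ring

/-- `frameComb τ a` as a continuous linear map. -/
def frameCombL (τ : ℝ) (a : Fin 3 → ℝ) : R42 →L[ℝ] R42 :=
  LinearMap.toContinuousLinearMap
    { toFun := frameComb τ a
      map_add' := by
        intro x y
        ext i
        fin_cases i <;> simp [frameComb_apply] <;> ring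
      map_smul' := by
        intro c x
        ext i
        fin_cases i <;> simp [frameComb_apply] <;> ring }

lemma frameCombL_apply (τ : ℝ) (a : Fin 3 → ℝ) (q : R42) : frameCombL τ a q = frameComb τ a q :=
  rfl

lemma differentiable_quad : Differentiable ℝ quad := by
  unfold quad pinner
  fun_prop

lemma fderiv_quad (p v : R42) : fderiv ℝ quad p v = 2 * pinner p v := by
  have h : ∀ i : Fin 4, HasFDerivAt (fun q : R42 => q i)
      (ContinuousLinearMap.proj (R := ℝ) (φ := fun _ : Fin 4 => ℝ) i) p :=
    fun i => (ContinuousLinearMap.proj (R := ℝ) (φ := fun _ : Fin 4 => ℝ) i).hasFDerivAt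
  have h2 : HasFDerivAt quad _ p :=
    ((((h 0).mul (h 0)).add ((h 1).mul (h 1))).sub ((h 2).mul (h 2))).sub ((h 3).mul (h 3))
  rw [h2.fderiv]
  simp [pinner]
  ring

lemma fderiv_comp_quad {G : ℝ → ℝ} {p v : R42} (hG : DifferentiableAt ℝ G (quad p))
    (hv : pinner p v = 0) : fderiv ℝ (fun q => G (quad q)) p v = 0 := by
  have := (hG.hasFDerivAt.comp p (differentiable_quad p).hasFDerivAt).fderiv
  change fderiv ℝ (fun q => G (quad q)) p = _ at this
  rw [this]
  simp [fderiv_quad, hv]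

/-- Off the pseudo-sphere the ambient `nabla` of frame fields has coefficients that depend on
`quad`. Along directions tangent to the levels of `quad` these count as constants, so only the
linear frame is differentiated. -/
lemma fderiv_frameComb (τ : ℝ) {f : ℝ → Fin 3 → ℝ} {p v : R42}
    (hf : DifferentiableAt ℝ f (quad p)) (hv : pinner p v = 0) :
    fderiv ℝ (fun q => frameComb τ (f (quad q)) q) p v = frameComb τ (f (quad p)) v := by
  have hfi : ∀ i, DifferentiableAt ℝ (fun n => f n i) (quad p) := fun i =>
    differentiableAt_pi.1 hf i
  have hc : ∀ i, DifferentiableAt ℝ (fun q => f (quad q) i) p := fun i =>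
    (hfi i).comp p (differentiable_quad p)
  have h : ∀ i : Fin 3, HasFDerivAt (fun q => f (quad q) i • frame τ i q) _ p := fun i => by
    have hL := (frameCombL τ (Pi.single i 1)).hasFDerivAt (x := p)
    have hL' : HasFDerivAt (frame τ i) (frameCombL τ (Pi.single i 1)) p := by
      rw [frame_eq_frameComb]; exact hL
    exact (hc i).hasFDerivAt.smul hL'
  have h2 := HasFDerivAt.fun_sum (u := Finset.univ) fun i _ => h i
  change HasFDerivAt (fun q => frameComb τ (f (quad q)) q) _ p at h2
  rw [h2.fderiv]
  simp [frameCombL_apply, fderiv_comp_quad (hfi _) hv, frameComb]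

lemma lieBracket_frameComb {τ : ℝ} (hτ : τ ≠ 0) {f g : ℝ → Fin 3 → ℝ} {p : R42}
    (hf : DifferentiableAt ℝ f (quad p)) (hg : DifferentiableAt ℝ g (quad p)) :
    VectorField.lieBracket ℝ (fun q => frameComb τ (f (quad q)) q)
      (fun q => frameComb τ (g (quad q)) q) p
      = frameComb τ (br τ (f (quad p)) (g (quad p))) p := by
  rw [VectorField.lieBracket, fderiv_frameComb τ hg (pinner_frameComb _ _ _),
    fderiv_frameComb τ hf (pinner_frameComb _ _ _), frameComb_comm hτ]

lemma differentiableAt_gram (τ : ℝ) {f g : ℝ → Fin 3 → ℝ} {n : ℝ}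
    (hf : DifferentiableAt ℝ f n) (hg : DifferentiableAt ℝ g n) :
    DifferentiableAt ℝ (fun n => gram τ n (f n) (g n)) n := by
  have hfi := differentiableAt_pi.1 hf
  have hgi := differentiableAt_pi.1 hg
  unfold gram
  fun_prop

lemma koszul_frameComb {τ : ℝ} (hτ : τ ≠ 0) {f g h : ℝ → Fin 3 → ℝ} {p : R42}
    (hf : DifferentiableAt ℝ f (quad p)) (hg : DifferentiableAt ℝ g (quad p))
    (hh : DifferentiableAt ℝ h (quad p)) :
    koszul τ (fun q => frameComb τ (f (quad q)) q) (fun q => frameComb τ (g (quad q)) q)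
      (fun q => frameComb τ (h (quad q)) q) p
      = kosz τ (quad p) (f (quad p)) (g (quad p)) (h (quad p)) := by
  unfold koszul
  simp only [metric_frameComb, lieBracket_frameComb hτ hf hg, lieBracket_frameComb hτ hf hh,
    lieBracket_frameComb hτ hg hh]
  rw [fderiv_comp_quad (differentiableAt_gram τ hg hh) (pinner_frameComb _ _ _),
    fderiv_comp_quad (differentiableAt_gram τ hf hh) (pinner_frameComb _ _ _),
    fderiv_comp_quad (differentiableAt_gram τ hf hg) (pinner_frameComb _ _ _), kosz]
  ring

lemma nabla_frameComb {τ : ℝ} (hτ : τ ≠ 0) {f g : ℝ → Fin 3 → ℝ} {p : R42}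
    (hf : DifferentiableAt ℝ f (quad p)) (hg : DifferentiableAt ℝ g (quad p)) :
    nabla τ (fun q => frameComb τ (f (quad q)) q) (fun q => frameComb τ (g (quad q)) q) p
      = frameComb τ (fun k => kosz τ (quad p) (f (quad p)) (g (quad p)) (Pi.single k 1)) p := by
  unfold nabla
  conv_rhs => unfold frameComb
  refine Finset.sum_congr rfl fun k _ => ?_
  congr 1
  rw [frame_eq_frameComb]
  exact koszul_frameComb (h := fun _ => Pi.single k 1) hτ hf hg (differentiableAt_const _)

lemma kosz_one {τ : ℝ} (hτ : τ ≠ 0) (a b : Fin 3 → ℝ) :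
    (fun k => kosz τ 1 a b (Pi.single k 1)) = conn τ a b := by
  ext k
  fin_cases k <;> simp [kosz, conn, gram, br] <;> field_simp <;> ring

lemma quad_of_mem {p : R42} (hp : p ∈ SL2) : quad p = 1 := hp

lemma nabla_frameComb_of_mem {τ : ℝ} (hτ : τ ≠ 0) {f g : ℝ → Fin 3 → ℝ} {p : R42}
    (hp : p ∈ SL2)
    (hf : DifferentiableAt ℝ f 1) (hg : DifferentiableAt ℝ g 1) :
    nabla τ (fun q => frameComb τ (f (quad q)) q) (fun q => frameComb τ (g (quad q)) q) p
      = frameComb τ (conn τ (f 1) (g 1)) p := by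
  have h1 := quad_of_mem hp
  rw [nabla_frameComb hτ (by rwa [h1]) (by rwa [h1]), h1, kosz_one hτ]

lemma differentiable_kosz (τ : ℝ) (a b : Fin 3 → ℝ) :
    Differentiable ℝ fun n => fun k : Fin 3 => kosz τ n a b (Pi.single k 1) := by
  unfold kosz gram
  fun_prop

lemma curvField_frameComb {τ : ℝ} (hτ : τ ≠ 0) (a b c : Fin 3 → ℝ) {p : R42} (hp : p ∈ SL2) :
    curvField τ (frameComb τ a) (frameComb τ b) (frameComb τ c) p
      = frameComb τ (conn τ a (conn τ b c) - conn τ b (conn τ a c) - conn τ (br τ a b) c) p := by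
  have hn : ∀ x y : Fin 3 → ℝ, nabla τ (frameComb τ x) (frameComb τ y)
      = fun q => frameComb τ (fun k => kosz τ (quad q) x y (Pi.single k 1)) q := fun x y =>
    funext fun q => nabla_frameComb (f := fun _ => x) (g := fun _ => y) hτ
      (differentiableAt_const _) (differentiableAt_const _)
  have hl : VectorField.lieBracket ℝ (frameComb τ a) (frameComb τ b) = frameComb τ (br τ a b) :=
    funext fun q => lieBracket_frameComb (f := fun _ => a) (g := fun _ => b) hτ
      (differentiableAt_const _) (differentiableAt_const _)
  -- The outer derivative is an ambient one, so the inner field must be known near p and not only on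
  -- `SL2`; hence `kosz` at a general level n.
  have hnn : ∀ x y z : Fin 3 → ℝ, nabla τ (frameComb τ x) (nabla τ (frameComb τ y)
      (frameComb τ z)) p = frameComb τ (conn τ x (conn τ y z)) p := fun x y z => by
    rw [hn, ← kosz_one hτ y z]
    exact nabla_frameComb_of_mem (f := fun _ => x)
      (g := fun n k => kosz τ n y z (Pi.single k 1)) hτ hp
      (differentiableAt_const _) (differentiable_kosz τ y z 1)
  rw [curvField, hl, hnn, hnn, frameComb_sub, frameComb_sub, hn, ← kosz_one hτ (br τ a b),
    ← quad_of_mem hp]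

/-! ### Tangent vectors and covariant derivatives in coefficients -/

/-- The coefficients of a tangent vector in the frame. -/
def coef (τ : ℝ) (p x : R42) : Fin 3 → ℝ := fun i => metric τ p x (frame τ i p)

lemma extend_eq (τ : ℝ) (p x : R42) : extend τ p x = frameComb τ (coef τ p x) := rfl

lemma gram_one {τ : ℝ} (hτ : τ ≠ 0) (a b : Fin 3 → ℝ) :
    gram τ 1 a b = a 0 * b 0 + a 1 * b 1 + a 2 * b 2 := by
  unfold gram
  field_simp
  ring

lemma coef_frameComb {τ : ℝ} (hτ : τ ≠ 0) (a : Fin 3 → ℝ) {p : R42} (hp : p ∈ SL2) :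
    coef τ p (frameComb τ a p) = a := by
  ext i
  rw [coef, frame_eq_frameComb, metric_frameComb, quad_of_mem hp, gram_one hτ]
  fin_cases i <;> simp

/-- On the pseudo-sphere p, X₁, X₂, X₃ form a pseudo-orthonormal basis of ℝ⁴₂, and x has no
p-component. -/
lemma frameComb_coef {τ : ℝ} (hτ : τ ≠ 0) {p x : R42} (hp : p ∈ SL2) (hx : pinner p x = 0) :
    frameComb τ (coef τ p x) p = x := by
  have h1 : p 0 * p 0 + p 1 * p 1 - p 2 * p 2 - p 3 * p 3 = 1 := hp
  have h2 : p 0 * x 0 + p 1 * x 1 - p 2 * x 2 - p 3 * x 3 = 0 := hx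
  have c0 : coef τ p x 0 = -τ * pinner x (X1 p) := by
    simp only [coef, metric, frame]
    simp [pinner, X1]
    field_simp
    linear_combination (-x 0 * p 1 + x 1 * p 0 + x 2 * p 3 - x 3 * p 2) * (1 + τ ^ 2) * (-h1)
  have c1 : coef τ p x 1 = -pinner x (X2 p) := by
    simp [coef, metric, frame, pinner, X1, X2]
    right
    ring
  have c2 : coef τ p x 2 = -pinner x (X3 p) := by
    simp [coef, metric, frame, pinner, X1, X3]
    right
    ring
  rw [frameComb_apply, c0, c1, c2]
  ext i
  fin_cases i <;> simp [pinner, X1, X2, X3] <;> field_simp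
  · linear_combination x 0 * h1 - p 0 * h2
  · linear_combination x 1 * h1 - p 1 * h2
  · linear_combination x 2 * h1 - p 2 * h2
  · linear_combination x 3 * h1 - p 3 * h2

lemma curv_eq {τ : ℝ} (hτ : τ ≠ 0) {p : R42} (hp : p ∈ SL2) (x y z : R42) :
    curv τ p x y z = frameComb τ (conn τ (coef τ p x) (conn τ (coef τ p y) (coef τ p z))
      - conn τ (coef τ p y) (conn τ (coef τ p x) (coef τ p z))
      - conn τ (br τ (coef τ p x) (coef τ p y)) (coef τ p z)) p := by
  rw [curv, extend_eq, extend_eq, extend_eq, curvField_frameComb hτ _ _ _ hp]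

/-- The coefficients of a vector field along a curve. -/
def coefAlong (τ : ℝ) (γ V : ℝ → R42) (s : ℝ) : Fin 3 → ℝ := coef τ (γ s) (V s)

lemma covDeriv_eq {τ : ℝ} (hτ : τ ≠ 0) (γ V : ℝ → R42) {s : ℝ} (hs : γ s ∈ SL2) :
    covDeriv τ γ V s = frameComb τ ((fun j => deriv (fun t => coefAlong τ γ V t j) s)
      + conn τ (coefAlong τ γ (deriv γ) s) (coefAlong τ γ V s)) (γ s) := by
  have hn : ∀ j, nabla τ (extend τ (γ s) (deriv γ s)) (frame τ j) (γ s)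
      = frameComb τ (conn τ (coefAlong τ γ (deriv γ) s) (Pi.single j 1)) (γ s) := fun j => by
    rw [extend_eq, frame_eq_frameComb]
    exact nabla_frameComb_of_mem (f := fun _ => coef τ (γ s) (deriv γ s))
      (g := fun _ => Pi.single j 1) hτ hs (differentiableAt_const _) (differentiableAt_const _)
  rw [covDeriv]
  simp only [hn]
  rw [Finset.sum_add_distrib, frameComb_add]
  congr 1
  have hV : ∀ j, metric τ (γ s) (V s) (frame τ j (γ s)) = coefAlong τ γ V s j := fun _ => rfl
  simp only [hV, Fin.sum_univ_three]
  ext i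
  fin_cases i <;> simp [frameComb_apply, conn] <;> ring

lemma coefAlong_covDeriv {τ : ℝ} (hτ : τ ≠ 0) (γ V : ℝ → R42) {s : ℝ} (hs : γ s ∈ SL2) :
    coefAlong τ γ (covDeriv τ γ V) s = (fun j => deriv (fun t => coefAlong τ γ V t j) s)
      + conn τ (coefAlong τ γ (deriv γ) s) (coefAlong τ γ V s) := by
  rw [coefAlong, covDeriv_eq hτ γ V hs, coef_frameComb hτ _ hs]

/-- The value `R(x, y) x` of the curvature tensor in frame coefficients. -/
def curvCoef (τ : ℝ) (x y : Fin 3 → ℝ) : Fin 3 → ℝ :=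
  conn τ x (conn τ y x) - conn τ y (conn τ x x) - conn τ (br τ x y) x

/-- Planes containing E₁ have curvature τ², horizontal planes -4 - 3τ². The difference 4(1 + τ²)
multiplies a correction along E₁ × x, which is horizontal and orthogonal to x. -/
lemma curvCoef_eq {τ : ℝ} (hτ : τ ≠ 0) {x y : Fin 3 → ℝ}
    (hx : x 0 ^ 2 + x 1 ^ 2 + x 2 ^ 2 = 1) (hxy : x 0 * y 0 + x 1 * y 1 + x 2 * y 2 = 0) :
    curvCoef τ x y = ![-(τ ^ 2 * y 0),
      -(τ ^ 2 * y 1) - 4 * (1 + τ ^ 2) * (x 1 * y 2 - x 2 * y 1) * x 2,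
      -(τ ^ 2 * y 2) + 4 * (1 + τ ^ 2) * (x 1 * y 2 - x 2 * y 1) * x 1] := by
  ext i
  fin_cases i <;> simp [curvCoef, conn, br] <;> field_simp
  · linear_combination -(τ ^ 2 * y 0) * hx + τ ^ 2 * x 0 * hxy
  · linear_combination -(τ ^ 4 * y 1) * hx + τ ^ 4 * x 1 * hxy
  · linear_combination -(τ ^ 4 * y 2) * hx + τ ^ 4 * x 2 * hxy

lemma eq_of_hasDerivAt_zero {I : Set ℝ} (hI : IsOpen I) (hc : I.OrdConnected) {f : ℝ → ℝ}
    (hf : ∀ s ∈ I, HasDerivAt f 0 s) {s t : ℝ} (hs : s ∈ I) (ht : t ∈ I) : f s = f t :=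
  hI.is_const_of_deriv_eq_zero hc.isPreconnected
    (fun x hx => (hf x hx).differentiableAt.differentiableWithinAt)
    (fun x hx => (hf x hx).deriv) hs ht

/-- A function that agrees with a differentiable one on an open set has the same derivative. -/
lemma deriv_eq_of_eqOn {I : Set ℝ} (hI : IsOpen I) {f g : ℝ → ℝ} {f' g' s : ℝ} (hs : s ∈ I)
    (hfg : ∀ t ∈ I, f t = g t) (hf : HasDerivAt f f' s) (hg : HasDerivAt g g' s) : f' = g' :=
  hf.unique (hg.congr_of_eventuallyEq (Filter.eventually_of_mem (hI.mem_nhds hs) hfg))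

lemma deriv_eq_zero_of_const {I : Set ℝ} (hI : IsOpen I) {f : ℝ → ℝ} {c f' s : ℝ} (hs : s ∈ I)
    (hf : ∀ t ∈ I, f t = c) (hd : HasDerivAt f f' s) : f' = 0 :=
  deriv_eq_of_eqOn hI hs hf hd (hasDerivAt_const s c)

/-! ### The biharmonic ODE system and its first integrals -/

/-- The biharmonic equation in frame coefficients: `T` is the unit tangent, `V = D T`,
`U = D V` and `D U = R(T, V) T`. -/
structure FrameSystem (τ : ℝ) (I : Set ℝ) (T V U : ℝ → Fin 3 → ℝ) : Prop where
  unit : ∀ s ∈ I, T s 0 ^ 2 + T s 1 ^ 2 + T s 2 ^ 2 = 1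
  hasDerivAt_T : ∀ s ∈ I, ∀ i, HasDerivAt (fun t => T t i) ((V s - conn τ (T s) (T s)) i) s
  hasDerivAt_V : ∀ s ∈ I, ∀ i, HasDerivAt (fun t => V t i) ((U s - conn τ (T s) (V s)) i) s
  hasDerivAt_U : ∀ s ∈ I, ∀ i,
    HasDerivAt (fun t => U t i) ((curvCoef τ (T s) (V s) - conn τ (T s) (U s)) i) s

/-- The Euclidean inner product of coefficient vectors. -/
def dot (a b : Fin 3 → ℝ) : ℝ := a 0 * b 0 + a 1 * b 1 + a 2 * b 2

/-- The determinant of three coefficient vectors. -/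
def triple (a b c : Fin 3 → ℝ) : ℝ :=
  a 0 * (b 1 * c 2 - b 2 * c 1) + a 1 * (b 2 * c 0 - b 0 * c 2) + a 2 * (b 0 * c 1 - b 1 * c 0)

/-- The vertical component of the cross product. -/
def vert (a b : Fin 3 → ℝ) : ℝ := a 1 * b 2 - a 2 * b 1

/-- `conn τ x` is skew-symmetric, so the connection terms cancel. -/
lemma hasDerivAt_dot {τ s : ℝ} {x a' b' : Fin 3 → ℝ} {a b : ℝ → Fin 3 → ℝ}
    (ha : ∀ i, HasDerivAt (fun t => a t i) ((a' - conn τ x (a s)) i) s)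
    (hb : ∀ i, HasDerivAt (fun t => b t i) ((b' - conn τ x (b s)) i) s) :
    HasDerivAt (fun t => dot (a t) (b t)) (dot a' (b s) + dot (a s) b') s := by
  have h := (((ha 0).fun_mul (hb 0)).fun_add ((ha 1).fun_mul (hb 1))).fun_add
    ((ha 2).fun_mul (hb 2))
  refine h.congr_deriv ?_
  simp [dot, conn]
  ring

/-- Skew-symmetric maps have trace zero, so the volume form is parallel too. -/
lemma hasDerivAt_triple {τ s : ℝ} {x a' b' c' : Fin 3 → ℝ} {a b c : ℝ → Fin 3 → ℝ}
    (ha : ∀ i, HasDerivAt (fun t => a t i) ((a' - conn τ x (a s)) i) s)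
    (hb : ∀ i, HasDerivAt (fun t => b t i) ((b' - conn τ x (b s)) i) s)
    (hc : ∀ i, HasDerivAt (fun t => c t i) ((c' - conn τ x (c s)) i) s) :
    HasDerivAt (fun t => triple (a t) (b t) (c t))
      (triple a' (b s) (c s) + triple (a s) b' (c s) + triple (a s) (b s) c') s := by
  have h := (((ha 0).fun_mul (((hb 1).fun_mul (hc 2)).fun_sub ((hb 2).fun_mul (hc 1)))).fun_add
    ((ha 1).fun_mul (((hb 2).fun_mul (hc 0)).fun_sub ((hb 0).fun_mul (hc 2))))).fun_add
    ((ha 2).fun_mul (((hb 0).fun_mul (hc 1)).fun_sub ((hb 1).fun_mul (hc 0))))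
  refine h.congr_deriv ?_
  simp [triple, conn]
  ring

namespace FrameSystem

variable {τ : ℝ} {I : Set ℝ} {T V U : ℝ → Fin 3 → ℝ}

lemma dot_T_T (h : FrameSystem τ I T V U) {s : ℝ} (hs : s ∈ I) : dot (T s) (T s) = 1 := by
  rw [← h.unit s hs, dot]
  ring

lemma dot_T_V (h : FrameSystem τ I T V U) (hI : IsOpen I) {s : ℝ} (hs : s ∈ I) :
    dot (T s) (V s) = 0 := by
  have h1 := deriv_eq_zero_of_const hI hs (fun t ht => h.dot_T_T ht)
    (hasDerivAt_dot (h.hasDerivAt_T s hs) (h.hasDerivAt_T s hs))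
  simp only [dot] at h1 ⊢
  linear_combination h1 / 2

lemma dot_T_U (h : FrameSystem τ I T V U) (hI : IsOpen I) {s : ℝ} (hs : s ∈ I) :
    dot (V s) (V s) + dot (T s) (U s) = 0 :=
  deriv_eq_zero_of_const hI hs (fun _ ht => h.dot_T_V hI ht)
    (hasDerivAt_dot (h.hasDerivAt_T s hs) (h.hasDerivAt_V s hs))

lemma curvCoef_eq (h : FrameSystem τ I T V U) (hτ : τ ≠ 0) (hI : IsOpen I) {s : ℝ}
    (hs : s ∈ I) : curvCoef τ (T s) (V s) = ![-(τ ^ 2 * V s 0),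
      -(τ ^ 2 * V s 1) - 4 * (1 + τ ^ 2) * vert (T s) (V s) * T s 2,
      -(τ ^ 2 * V s 2) + 4 * (1 + τ ^ 2) * vert (T s) (V s) * T s 1] :=
  SLtau.curvCoef_eq hτ (h.unit s hs) (h.dot_T_V hI hs)

/-- The tangential component of the biharmonic equation: differentiating V·V + T·U = 0 gives 3 V·U,
since R(T, V)T is orthogonal to T. -/
lemma dot_V_U (h : FrameSystem τ I T V U) (hτ : τ ≠ 0) (hI : IsOpen I) {s : ℝ} (hs : s ∈ I) :
    dot (V s) (U s) = 0 := by
  have h1 := deriv_eq_zero_of_const hI hs (fun _ ht => h.dot_T_U hI ht)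
    ((hasDerivAt_dot (h.hasDerivAt_V s hs) (h.hasDerivAt_V s hs)).fun_add
      (hasDerivAt_dot (h.hasDerivAt_T s hs) (h.hasDerivAt_U s hs)))
  have h2 := h.dot_T_V hI hs
  rw [h.curvCoef_eq hτ hI hs] at h1
  simp [dot] at h1 h2 ⊢
  linear_combination h1 / 3 + τ ^ 2 / 3 * h2

lemma dot_V_V_const (h : FrameSystem τ I T V U) (hτ : τ ≠ 0) (hI : IsOpen I)
    (hc : I.OrdConnected) {s t : ℝ} (hs : s ∈ I) (ht : t ∈ I) :
    dot (V s) (V s) = dot (V t) (V t) := by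
  refine eq_of_hasDerivAt_zero hI hc (f := fun s => dot (V s) (V s)) (fun r hr => ?_) hs ht
  refine (hasDerivAt_dot (h.hasDerivAt_V r hr) (h.hasDerivAt_V r hr)).congr_deriv ?_
  have := h.dot_V_U hτ hI hr
  simp only [dot] at this ⊢
  linear_combination 2 * this

/-- The normal component of the biharmonic equation. -/
lemma dot_U_U (h : FrameSystem τ I T V U) (hτ : τ ≠ 0) (hI : IsOpen I) {s : ℝ} (hs : s ∈ I) :
    dot (U s) (U s) + 4 * (1 + τ ^ 2) * vert (T s) (V s) ^ 2 = τ ^ 2 * dot (V s) (V s) := by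
  have h1 := deriv_eq_zero_of_const hI hs (fun _ ht => h.dot_V_U hτ hI ht)
    (hasDerivAt_dot (h.hasDerivAt_V s hs) (h.hasDerivAt_U s hs))
  rw [h.curvCoef_eq hτ hI hs] at h1
  simp [dot, vert] at h1 ⊢
  linear_combination h1

/-- The binormal component of the biharmonic equation. -/
lemma hasDerivAt_triple_U (h : FrameSystem τ I T V U) (hτ : τ ≠ 0) (hI : IsOpen I) {s : ℝ}
    (hs : s ∈ I) : HasDerivAt (fun t => triple (U t) (T t) (V t))
      (-(4 * (1 + τ ^ 2) * vert (T s) (V s) * V s 0)) s := by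
  refine (hasDerivAt_triple (h.hasDerivAt_U s hs) (h.hasDerivAt_T s hs)
    (h.hasDerivAt_V s hs)).congr_deriv ?_
  have h0 := h.dot_T_T hs
  have h2 := h.dot_T_V hI hs
  rw [h.curvCoef_eq hτ hI hs]
  simp [dot, vert, triple] at h0 h2 ⊢
  linear_combination 4 * (1 + τ ^ 2) * (T s 1 * V s 2 - T s 2 * V s 1) *
    (T s 0 * h2 - V s 0 * h0)

lemma hasDerivAt_T_zero (h : FrameSystem τ I T V U) {s : ℝ} (hs : s ∈ I) :
    HasDerivAt (fun t => T t 0) (V s 0) s := by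
  refine (h.hasDerivAt_T s hs 0).congr_deriv ?_
  have : conn τ (T s) (T s) 0 = 0 := by
    simp only [conn, Matrix.cons_val_zero]
    ring
  simp [this]

/-- The covariant derivative of T × V is T × U. The extra term comes from ∇_T E₁ = τ T × E₁ paired
with T × V. -/
lemma hasDerivAt_vert (h : FrameSystem τ I T V U) (hI : IsOpen I) {s : ℝ} (hs : s ∈ I) :
    HasDerivAt (fun t => vert (T t) (V t)) (vert (T s) (U s) + τ * V s 0) s := by
  refine (((h.hasDerivAt_T s hs 1).fun_mul (h.hasDerivAt_V s hs 2)).fun_sub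
    ((h.hasDerivAt_T s hs 2).fun_mul (h.hasDerivAt_V s hs 1))).congr_deriv ?_
  have h0 := h.dot_T_T hs
  have h2 := h.dot_T_V hI hs
  simp [conn, vert, dot] at h0 h2 ⊢
  linear_combination τ * V s 0 * h0 - τ * T s 0 * h2

/-- U has no V-component, so T × U comes only from its component along T × V, and T × (T × V) = -V.
-/
lemma dot_V_V_mul_vert (h : FrameSystem τ I T V U) (hτ : τ ≠ 0) (hI : IsOpen I) {s : ℝ}
    (hs : s ∈ I) : dot (V s) (V s) * vert (T s) (U s)
      = -(triple (U s) (T s) (V s) * V s 0) := by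
  have h0 := h.dot_T_T hs
  have h1 := h.dot_T_V hI hs
  have h2 := h.dot_V_U hτ hI hs
  have key : (dot (T s) (T s) * dot (V s) (V s) - dot (T s) (V s) ^ 2) * vert (T s) (U s)
      = triple (U s) (T s) (V s) * (T s 0 * dot (T s) (V s) - V s 0 * dot (T s) (T s))
        + (dot (V s) (U s) * dot (T s) (T s) - dot (T s) (U s) * dot (T s) (V s))
          * vert (T s) (V s) := by
    simp only [triple, dot, vert]
    ring
  rw [h0, h1, h2] at key
  linear_combination key

/-- The square of the determinant is the Gram determinant, here nearly diagonal. -/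
lemma triple_sq (h : FrameSystem τ I T V U) (hτ : τ ≠ 0) (hI : IsOpen I) {s : ℝ}
    (hs : s ∈ I) : triple (U s) (T s) (V s) ^ 2
      = dot (V s) (V s) * (dot (U s) (U s) - dot (V s) (V s) ^ 2) := by
  have h0 := h.dot_T_T hs
  have h1 := h.dot_T_V hI hs
  have h2 := h.dot_V_U hτ hI hs
  have h3 := h.dot_T_U hI hs
  have gramdet : triple (U s) (T s) (V s) ^ 2
      = dot (U s) (U s) * (dot (T s) (T s) * dot (V s) (V s) - dot (T s) (V s) ^ 2)
        - dot (T s) (U s) * (dot (T s) (U s) * dot (V s) (V s) - dot (T s) (V s) * dot (V s) (U s))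
        + dot (V s) (U s) * (dot (T s) (U s) * dot (T s) (V s) - dot (T s) (T s) * dot (V s) (U s))
      := by
    simp only [triple, dot]
    ring
  rw [gramdet, h0, h1, h2, eq_neg_of_add_eq_zero_right h3]
  ring

lemma vert_mul_V_zero (h : FrameSystem τ I T V U) (hτ : τ ≠ 0) (hI : IsOpen I)
    (hc : I.OrdConnected) {s : ℝ} (hs : s ∈ I) : vert (T s) (V s) * V s 0 = 0 := by
  set K := dot (V s) (V s) with hK
  have hKt : ∀ t ∈ I, dot (V t) (V t) = K := fun t ht => h.dot_V_V_const hτ hI hc ht hs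
  have hδ : (1 : ℝ) + τ ^ 2 ≠ 0 := by positivity
  -- Eliminating |U|² between `triple_sq` and `dot_U_U` gives a conserved quantity; its derivative
  -- factors as in `hprod`.
  have hcons : ∀ t ∈ I, triple (U t) (T t) (V t) ^ 2
      + 4 * (1 + τ ^ 2) * K * vert (T t) (V t) ^ 2 = τ ^ 2 * K ^ 2 - K ^ 3 := fun t ht => by
    have h1 := h.triple_sq hτ hI ht
    have h2 := h.dot_U_U hτ hI ht
    rw [hKt t ht] at h1 h2
    linear_combination h1 + K * h2
  have hprod : ∀ t ∈ I, vert (T t) (V t) * V t 0 * (2 * triple (U t) (T t) (V t) - τ * K) = 0 :=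
    fun t ht => by
    have hP := h.hasDerivAt_triple_U hτ hI ht
    have hW := h.hasDerivAt_vert hI ht
    have h0 := deriv_eq_zero_of_const hI ht hcons
      ((hP.fun_pow 2).fun_add ((hW.fun_pow 2).const_mul (4 * (1 + τ ^ 2) * K)))
    have h1 := h.dot_V_V_mul_vert hτ hI ht
    rw [hKt t ht] at h1
    have h3 : (4 * (1 + τ ^ 2)) * (vert (T t) (V t) * V t 0 *
        (2 * triple (U t) (T t) (V t) - τ * K)) = 0 := by
      simp at h0
      linear_combination -h0 / 2 + 4 * (1 + τ ^ 2) * vert (T t) (V t) * h1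
    simpa [hδ] using h3
  by_contra hne
  have hcont : ContinuousAt (fun t => vert (T t) (V t) * V t 0) s :=
    (h.hasDerivAt_vert hI hs).continuousAt.mul (h.hasDerivAt_V s hs 0).continuousAt
  -- Near a point where the product is nonzero the triple product is constant, but its derivative is
  -- a nonzero multiple of that same product.
  have hev : (fun t => triple (U t) (T t) (V t)) =ᶠ[nhds s] fun _ => τ * K / 2 := by
    filter_upwards [hcont.eventually_ne hne, hI.mem_nhds hs] with t ht htI
    have := (mul_eq_zero.1 (hprod t htI)).resolve_left ht
    linarith
  have h0 := (h.hasDerivAt_triple_U hτ hI hs).unique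
    ((hasDerivAt_const s (τ * K / 2)).congr_of_eventuallyEq hev)
  rw [neg_eq_zero, mul_assoc] at h0
  exact hne ((mul_eq_zero.1 h0).resolve_left (by simp [hδ]))

lemma vert_const (h : FrameSystem τ I T V U) (hτ : τ ≠ 0) (hI : IsOpen I)
    (hc : I.OrdConnected) (hK : ∀ s ∈ I, dot (V s) (V s) ≠ 0) {s t : ℝ} (hs : s ∈ I)
    (ht : t ∈ I) : vert (T s) (V s) ^ 2 = vert (T t) (V t) ^ 2 := by
  have hP : triple (U s) (T s) (V s) = triple (U t) (T t) (V t) :=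
    eq_of_hasDerivAt_zero hI hc (f := fun s => triple (U s) (T s) (V s))
      (fun r hr => (h.hasDerivAt_triple_U hτ hI hr).congr_deriv (by
        rw [mul_assoc, h.vert_mul_V_zero hτ hI hc hr]; simp)) hs ht
  have hδ : 4 * (1 + τ ^ 2) ≠ 0 := by positivity
  have h1 := h.triple_sq hτ hI hs
  have h2 := h.dot_U_U hτ hI hs
  have h3 := h.triple_sq hτ hI ht
  have h4 := h.dot_U_U hτ hI ht
  rw [hP, h.dot_V_V_const hτ hI hc hs ht] at h1
  rw [h.dot_V_V_const hτ hI hc hs ht] at h2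
  refine mul_left_cancel₀ (mul_ne_zero hδ (hK t ht)) ?_
  linear_combination h1 - h3 + dot (V t) (V t) * (h2 - h4)

/-- The vertical component of the tension field vanishes. -/
lemma V_zero (h : FrameSystem τ I T V U) (hτ : τ ≠ 0) (hI : IsOpen I)
    (hc : I.OrdConnected) (hK : ∀ s ∈ I, dot (V s) (V s) ≠ 0) {s : ℝ} (hs : s ∈ I) :
    V s 0 = 0 := by
  by_contra hV
  have hW : vert (T s) (V s) = 0 :=
    (mul_eq_zero.1 (h.vert_mul_V_zero hτ hI hc hs)).resolve_right hV
  have hW' : ∀ t ∈ I, vert (T t) (V t) = 0 := fun t ht => by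
    simpa [hW] using h.vert_const hτ hI hc hK ht hs
  have h0 := deriv_eq_zero_of_const hI hs hW' (h.hasDerivAt_vert hI hs)
  have h1 := h.dot_V_V_mul_vert hτ hI hs
  have h2 := h.triple_sq hτ hI hs
  have h3 := h.dot_U_U hτ hI hs
  rw [hW] at h3
  -- With `vert` identically zero, this value turns `triple_sq` and `dot_U_U` into |V|⁶ = 0.
  have h4 : triple (U s) (T s) (V s) = τ * dot (V s) (V s) :=
    mul_right_cancel₀ hV (by linear_combination h1 - dot (V s) (V s) * h0)
  rw [h4] at h2
  exact hK s hs (pow_eq_zero_iff (n := 3) (by simp) |>.1 (by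
    linear_combination h2 + dot (V s) (V s) * h3))

/-- The horizontal part of a biharmonic tangent rotates with constant speed. -/
lemma exists_rotation (h : FrameSystem τ I T V U) (hτ : τ ≠ 0) (hI : IsOpen I)
    (hc : I.OrdConnected) (hK : ∀ s ∈ I, dot (V s) (V s) ≠ 0) {s₀ : ℝ} (hs₀ : s₀ ∈ I) :
    1 - T s₀ 0 ^ 2 ≠ 0 ∧ ∃ b, ∀ s ∈ I, T s 0 = T s₀ 0 ∧
      HasDerivAt (fun t => T t 1) (b * T s 2) s ∧
      HasDerivAt (fun t => T t 2) (-(b * T s 1)) s := by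
  have hT0 : ∀ s ∈ I, T s 0 = T s₀ 0 := fun s hs =>
    eq_of_hasDerivAt_zero hI hc (f := fun s => T s 0)
      (fun r hr => (h.hasDerivAt_T_zero hr).congr_deriv (h.V_zero hτ hI hc hK hr)) hs hs₀
  have hW : ∀ s ∈ I, vert (T s) (V s) = vert (T s₀) (V s₀) := fun s hs => by
    refine eq_of_hasDerivAt_zero hI hc (f := fun s => vert (T s) (V s))
      (fun r hr => (h.hasDerivAt_vert hI hr).congr_deriv ?_) hs hs₀
    have h1 := h.dot_V_V_mul_vert hτ hI hr
    rw [h.V_zero hτ hI hc hK hr, mul_zero, neg_zero] at h1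
    rw [h.V_zero hτ hI hc hK hr, (mul_eq_zero.1 h1).resolve_left (hK r hr)]
    ring
  have hS : 1 - T s₀ 0 ^ 2 ≠ 0 := fun hS => by
    have hz : ∀ s ∈ I, T s 1 = 0 ∧ T s 2 = 0 := fun s hs => by
      have h1 := h.unit s hs
      rw [hT0 s hs] at h1
      exact ⟨by nlinarith [sq_nonneg (T s 1), sq_nonneg (T s 2)],
        by nlinarith [sq_nonneg (T s 1), sq_nonneg (T s 2)]⟩
    have h1 := deriv_eq_zero_of_const hI hs₀ (fun t ht => (hz t ht).1) (h.hasDerivAt_T s₀ hs₀ 1)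
    have h2 := deriv_eq_zero_of_const hI hs₀ (fun t ht => (hz t ht).2) (h.hasDerivAt_T s₀ hs₀ 2)
    simp [conn, (hz s₀ hs₀).1, (hz s₀ hs₀).2] at h1 h2
    exact hK s₀ hs₀ (by simp [dot, h1, h2, h.V_zero hτ hI hc hK hs₀])
  -- V is horizontal and orthogonal to T, hence `vert / (1 - T₀²)` times the quarter turn of the
  -- horizontal part of T. The second term of b comes from `conn τ T T`.
  refine ⟨hS, -(vert (T s₀) (V s₀) / (1 - T s₀ 0 ^ 2)) - (2 * τ⁻¹ + τ + τ) * T s₀ 0, ?_⟩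
  intro s hs
  have hu := h.unit s hs
  have hd := h.dot_T_V hI hs
  have hw := hW s hs
  rw [hT0 s hs] at hu
  rw [dot, h.V_zero hτ hI hc hK hs] at hd
  have hq := div_mul_cancel₀ (vert (T s₀) (V s₀)) hS
  rw [vert] at hw
  refine ⟨hT0 s hs, (h.hasDerivAt_T s hs 1).congr_deriv ?_,
    (h.hasDerivAt_T s hs 2).congr_deriv ?_⟩
  · simp [conn, hT0 s hs]
    refine mul_left_cancel₀ hS ?_
    linear_combination T s 2 * hq - T s 2 * hw + T s 1 * hd - V s 1 * hu
  · simp [conn, hT0 s hs]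
    refine mul_left_cancel₀ hS ?_
    linear_combination -(T s 1 * hq) + T s 1 * hw + T s 2 * hd - V s 2 * hu

end FrameSystem

/-! ### From the curve to the system: constant angle -/

section Curve

variable {τ : ℝ} {I : Set ℝ} {γ : ℝ → R42}

namespace IsUnitSpeedCurve

lemma hasDerivAt (h : IsUnitSpeedCurve τ I γ) (hI : IsOpen I) {s : ℝ} (hs : s ∈ I) :
    HasDerivAt γ (deriv γ s) s :=
  ((h.smooth.contDiffAt (hI.mem_nhds hs)).differentiableAt (by simp)).hasDerivAt

lemma pinner_deriv (h : IsUnitSpeedCurve τ I γ) (hI : IsOpen I) {s : ℝ} (hs : s ∈ I) :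
    pinner (γ s) (deriv γ s) = 0 := by
  have h1 := (differentiable_quad (γ s)).hasFDerivAt.comp_hasDerivAt s (h.hasDerivAt hI hs)
  have h2 := deriv_eq_zero_of_const hI hs (fun t ht => quad_of_mem (h.mem t ht)) h1
  rw [fderiv_quad] at h2
  linarith

lemma deriv_eq (h : IsUnitSpeedCurve τ I γ) (hτ : τ ≠ 0) (hI : IsOpen I) {s : ℝ} (hs : s ∈ I) :
    deriv γ s = frameComb τ (coefAlong τ γ (deriv γ) s) (γ s) :=
  (frameComb_coef hτ (h.mem s hs) (h.pinner_deriv hI hs)).symm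

lemma contDiffOn_tangent (h : IsUnitSpeedCurve τ I γ) (hI : IsOpen I) (j : Fin 3) :
    ContDiffOn ℝ ∞ (fun s => coefAlong τ γ (deriv γ) s j) I := by
  have h1 := contDiffOn_pi.1 h.smooth
  have h2 := contDiffOn_pi.1 (h.smooth.deriv_of_isOpen (m := ∞) hI (by simp))
  fin_cases j <;> simp [coefAlong, coef, metric, pinner, frame, X1, X2, X3] <;> fun_prop

lemma contDiffOn_covDeriv (h : IsUnitSpeedCurve τ I γ) (hτ : τ ≠ 0) (hI : IsOpen I)
    {W : ℝ → R42} (hW : ∀ j, ContDiffOn ℝ ∞ (fun s => coefAlong τ γ W s j) I) (j : Fin 3) :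
    ContDiffOn ℝ ∞ (fun s => coefAlong τ γ (covDeriv τ γ W) s j) I := by
  have h1 := h.contDiffOn_tangent hI
  have h2 := (hW j).deriv_of_isOpen (m := ∞) hI (by simp)
  have h3 : ContDiffOn ℝ ∞ (fun s => deriv (fun t => coefAlong τ γ W t j) s
      + conn τ (coefAlong τ γ (deriv γ) s) (coefAlong τ γ W s) j) I := by
    refine h2.add ?_
    fin_cases j <;> simp [conn] <;> fun_prop
  refine h3.congr fun s hs => ?_
  rw [coefAlong_covDeriv hτ γ W (h.mem s hs)]
  rfl

lemma hasDerivAt_coefAlong (h : IsUnitSpeedCurve τ I γ) (hτ : τ ≠ 0) (hI : IsOpen I)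
    {W : ℝ → R42} (hW : ∀ j, ContDiffOn ℝ ∞ (fun s => coefAlong τ γ W s j) I) {s : ℝ}
    (hs : s ∈ I) (j : Fin 3) : HasDerivAt (fun t => coefAlong τ γ W t j)
      ((coefAlong τ γ (covDeriv τ γ W) s
        - conn τ (coefAlong τ γ (deriv γ) s) (coefAlong τ γ W s)) j) s := by
  rw [coefAlong_covDeriv hτ γ W (h.mem s hs), add_sub_cancel_right]
  exact (((hW j).contDiffAt (hI.mem_nhds hs)).differentiableAt (by simp)).hasDerivAt

end IsUnitSpeedCurve

/-- A biharmonic curve satisfies the biharmonic equation in frame coefficients. -/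
lemma frameSystem (hτ : τ ≠ 0) (hI : IsOpen I) (h : IsUnitSpeedCurve τ I γ)
    (hbi : ∀ s ∈ I, bitension τ γ s = 0) :
    FrameSystem τ I (coefAlong τ γ (deriv γ)) (coefAlong τ γ (tension τ γ))
      (coefAlong τ γ (covDeriv τ γ (tension τ γ))) := by
  have hT := h.contDiffOn_tangent hI
  have hV := h.contDiffOn_covDeriv hτ hI hT
  have hU := h.contDiffOn_covDeriv hτ hI hV
  refine ⟨fun s hs => ?_, fun s hs => h.hasDerivAt_coefAlong hτ hI hT hs,
    fun s hs => h.hasDerivAt_coefAlong hτ hI hV hs, fun s hs i => ?_⟩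
  · have h1 := h.unit_speed s hs
    have h2 := metric_frameComb τ (coefAlong τ γ (deriv γ) s) (coefAlong τ γ (deriv γ) s) (γ s)
    rw [← h.deriv_eq hτ hI hs, h1, quad_of_mem (h.mem s hs), gram_one hτ] at h2
    linear_combination -h2
  · have h1 := h.hasDerivAt_coefAlong hτ hI hU hs i
    have h2 := sub_eq_zero.1 (hbi s hs)
    rw [curv_eq hτ (h.mem s hs)] at h2
    change HasDerivAt _ ((coef τ (γ s) (covDeriv τ γ (covDeriv τ γ (tension τ γ)) s)
      - conn τ _ _) i) s at h1
    rwa [h2, coef_frameComb hτ _ (h.mem s hs)] at h1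

lemma tension_eq (hτ : τ ≠ 0) {s : ℝ} (hs : γ s ∈ SL2) :
    tension τ γ s = frameComb τ (coefAlong τ γ (tension τ γ) s) (γ s) := by
  rw [tension, coefAlong_covDeriv hτ γ _ hs, covDeriv_eq hτ γ _ hs]

lemma dot_tension_ne_zero (hτ : τ ≠ 0) (hI : IsOpen I) (hc : I.OrdConnected)
    (h : IsUnitSpeedCurve τ I γ) (hbi : IsProperBiharmonic τ I γ) {s : ℝ} (hs : s ∈ I) :
    dot (coefAlong τ γ (tension τ γ) s) (coefAlong τ γ (tension τ γ) s) ≠ 0 := by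
  intro h0
  refine hbi.not_geodesic fun t ht => ?_
  have h1 := ((frameSystem hτ hI h hbi.biharmonic).dot_V_V_const hτ hI hc ht hs).trans h0
  rw [tension_eq hτ (h.mem t ht)]
  set v := coefAlong τ γ (tension τ γ) t
  rw [dot] at h1
  have e0 : v 0 = 0 := by nlinarith [sq_nonneg (v 0), sq_nonneg (v 1), sq_nonneg (v 2)]
  have e1 : v 1 = 0 := by nlinarith [sq_nonneg (v 0), sq_nonneg (v 1), sq_nonneg (v 2)]
  have e2 : v 2 = 0 := by nlinarith [sq_nonneg (v 0), sq_nonneg (v 1), sq_nonneg (v 2)]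
  simp [frameComb, Fin.sum_univ_three, e0, e1, e2]

lemma exists_polar {x y r : ℝ} (hr : 0 ≤ r) (h : x ^ 2 + y ^ 2 = r ^ 2) :
    ∃ φ, x = r * Real.sin φ ∧ y = r * Real.cos φ := by
  have hn : ‖(⟨y, x⟩ : ℂ)‖ = r := by
    rw [Complex.norm_eq_sqrt_sq_add_sq, add_comm, h, Real.sqrt_sq hr]
  refine ⟨Complex.arg ⟨y, x⟩, ?_, ?_⟩
  · rw [← hn, Complex.norm_mul_sin_arg]
  · rw [← hn, Complex.norm_mul_cos_arg]

/-- Solutions of the rotation system are circular motions. -/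
lemma exists_phase (hI : IsOpen I) (hc : I.OrdConnected) {x y : ℝ → ℝ} {b r : ℝ} (hr : 0 ≤ r)
    (hne : I.Nonempty) (hx : ∀ s ∈ I, HasDerivAt x (b * y s) s)
    (hy : ∀ s ∈ I, HasDerivAt y (-(b * x s)) s) (hxy : ∀ s ∈ I, x s ^ 2 + y s ^ 2 = r ^ 2) :
    ∃ φ, ∀ s ∈ I, x s = r * Real.sin (b * s + φ) ∧ y s = r * Real.cos (b * s + φ) := by
  obtain ⟨s₀, hs₀⟩ := hne
  have hsin : ∀ s, HasDerivAt (fun t => Real.sin (b * t)) (Real.cos (b * s) * b) s := fun s => by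
    simpa using ((hasDerivAt_id s).const_mul b).sin
  have hcos : ∀ s, HasDerivAt (fun t => Real.cos (b * t)) (-Real.sin (b * s) * b) s := fun s => by
    simpa using ((hasDerivAt_id s).const_mul b).cos
  -- Undoing the rotation by the angle bs turns (x, y) into a constant vector, whose polar angle is
  -- φ.
  have hp : ∀ s ∈ I, x s * Real.cos (b * s) - y s * Real.sin (b * s)
      = x s₀ * Real.cos (b * s₀) - y s₀ * Real.sin (b * s₀) := fun s hs =>
    eq_of_hasDerivAt_zero hI hc (f := fun s => x s * Real.cos (b * s) - y s * Real.sin (b * s))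
      (fun t ht => (((hx t ht).fun_mul (hcos t)).fun_sub
        ((hy t ht).fun_mul (hsin t))).congr_deriv (by ring)) hs hs₀
  have hq : ∀ s ∈ I, x s * Real.sin (b * s) + y s * Real.cos (b * s)
      = x s₀ * Real.sin (b * s₀) + y s₀ * Real.cos (b * s₀) := fun s hs =>
    eq_of_hasDerivAt_zero hI hc (f := fun s => x s * Real.sin (b * s) + y s * Real.cos (b * s))
      (fun t ht => (((hx t ht).fun_mul (hsin t)).fun_add
        ((hy t ht).fun_mul (hcos t))).congr_deriv (by ring)) hs hs₀
  obtain ⟨φ, h1, h2⟩ := exists_polar (x := x s₀ * Real.cos (b * s₀) - y s₀ * Real.sin (b * s₀))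
    (y := x s₀ * Real.sin (b * s₀) + y s₀ * Real.cos (b * s₀)) hr (by
      rw [← hxy s₀ hs₀]
      linear_combination (x s₀ ^ 2 + y s₀ ^ 2) * Real.sin_sq_add_cos_sq (b * s₀))
  refine ⟨φ, fun s hs => ?_⟩
  have hp' := (hp s hs).trans h1
  have hq' := (hq s hs).trans h2
  have hsc := Real.sin_sq_add_cos_sq (b * s)
  rw [Real.sin_add, Real.cos_add]
  constructor
  · linear_combination Real.cos (b * s) * hp' + Real.sin (b * s) * hq' - x s * hsc
  · linear_combination -Real.sin (b * s) * hp' + Real.cos (b * s) * hq' - y s * hsc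

/-- A proper biharmonic curve makes a constant angle with the Hopf field. -/
theorem exists_angleData (hτ : τ ≠ 0) (hI : IsOpen I) (hc : I.OrdConnected)
    (h : IsUnitSpeedCurve τ I γ) (hbi : IsProperBiharmonic τ I γ)
    (horient : ∀ s ∈ I, 0 ≤ metric τ (γ s) (deriv γ s) (frame τ 0 (γ s))) :
    ∃ (ϑ : ℝ) (β : ℝ → ℝ) (b : ℝ), HasAngleData τ I γ ϑ β b := by
  obtain ⟨s₀, hs₀⟩ : I.Nonempty := by
    by_contra hne
    rw [Set.not_nonempty_iff_eq_empty] at hne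
    exact hbi.not_geodesic (by simp [hne])
  have hsys := frameSystem hτ hI h hbi.biharmonic
  obtain ⟨hS, b, hb⟩ := hsys.exists_rotation hτ hI hc
    (fun s hs => dot_tension_ne_zero hτ hI hc h hbi hs) hs₀
  have hder := fun s hs => h.deriv_eq hτ hI (s := s) hs
  set T := coefAlong τ γ (deriv γ)
  have hT0 : 0 ≤ T s₀ 0 := horient s₀ hs₀
  have hu := hsys.unit
  have hT1 : T s₀ 0 ≤ 1 := by nlinarith [hu s₀ hs₀, sq_nonneg (T s₀ 1), sq_nonneg (T s₀ 2)]
  have hcos : Real.cos (Real.arccos (T s₀ 0)) = T s₀ 0 := Real.cos_arccos (by linarith) hT1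
  have hsin : Real.sin (Real.arccos (T s₀ 0)) ^ 2 = 1 - T s₀ 0 ^ 2 := by
    rw [Real.sin_sq, hcos]
  have hsin0 : 0 ≤ Real.sin (Real.arccos (T s₀ 0)) :=
    Real.sin_nonneg_of_nonneg_of_le_pi (Real.arccos_nonneg _) (Real.arccos_le_pi _)
  obtain ⟨φ, hφ⟩ := exists_phase hI hc (x := fun s => T s 1) (y := fun s => T s 2) hsin0
    ⟨s₀, hs₀⟩ (fun s hs => (hb s hs).2.1) (fun s hs => (hb s hs).2.2) (fun s hs => by
      rw [hsin, ← (hb s hs).1]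
      linear_combination hu s hs)
  refine ⟨Real.arccos (T s₀ 0), fun s => b * s + φ, b, ⟨?_, ?_⟩, ?_, fun s hs => ?_,
    fun s _ => ?_⟩
  · refine Real.arccos_pos.2 (lt_of_le_of_ne hT1 fun h1 => hS ?_)
    rw [h1]
    ring
  · exact Real.arccos_le_pi_div_two.2 hT0
  · fun_prop
  · rw [hder s hs, frameComb, Fin.sum_univ_three, hcos, (hb s hs).1, (hφ s hs).1, (hφ s hs).2]
  · simpa using ((hasDerivAt_id s).const_mul b).add_const φ

/-! ### Relation between angle and rotation speed -/

namespace HasAngleData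

variable {ϑ b : ℝ} {β : ℝ → ℝ}

lemma coefAlong_eq (hτ : τ ≠ 0) (h : IsUnitSpeedCurve τ I γ) (ha : HasAngleData τ I γ ϑ β b)
    {s : ℝ} (hs : s ∈ I) : coefAlong τ γ (deriv γ) s
      = ![Real.cos ϑ, Real.sin ϑ * Real.sin (β s), Real.sin ϑ * Real.cos (β s)] := by
  rw [coefAlong, ha.tangent s hs,
    ← coef_frameComb hτ ![Real.cos ϑ, Real.sin ϑ * Real.sin (β s), Real.sin ϑ * Real.cos (β s)]
      (h.mem s hs)]
  simp [frameComb, Fin.sum_univ_three]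

lemma hasDerivAt_sin (ha : HasAngleData τ I γ ϑ β b) (k : ℝ) {s : ℝ} (hs : s ∈ I) :
    HasDerivAt (fun t => k * Real.sin (β t)) (k * (Real.cos (β s) * b)) s :=
  (ha.hasDerivAt s hs).sin.const_mul k

lemma hasDerivAt_cos (ha : HasAngleData τ I γ ϑ β b) (k : ℝ) {s : ℝ} (hs : s ∈ I) :
    HasDerivAt (fun t => k * Real.cos (β t)) (k * (-Real.sin (β s) * b)) s :=
  (ha.hasDerivAt s hs).cos.const_mul k

/-- The equation for T is solved for V, with T' read off from β' = b. The factor (b + 2(τ⁻¹ + τ) cos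
ϑ) sin ϑ is, up to sign, the geodesic curvature. -/
lemma tension_coef (hτ : τ ≠ 0) (hI : IsOpen I) (h : IsUnitSpeedCurve τ I γ)
    (hbi : IsProperBiharmonic τ I γ) (ha : HasAngleData τ I γ ϑ β b) {s : ℝ} (hs : s ∈ I) :
    coefAlong τ γ (tension τ γ) s = ![0,
      (b + 2 * (τ⁻¹ + τ) * Real.cos ϑ) * Real.sin ϑ * Real.cos (β s),
      -((b + 2 * (τ⁻¹ + τ) * Real.cos ϑ) * Real.sin ϑ) * Real.sin (β s)] := by
  have hsys := frameSystem hτ hI h hbi.biharmonic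
  have hT := fun t (ht : t ∈ I) => ha.coefAlong_eq hτ h ht
  have d0 := deriv_eq_of_eqOn hI hs (fun t ht => by rw [hT t ht]; rfl)
    (hsys.hasDerivAt_T s hs 0) (hasDerivAt_const s (Real.cos ϑ))
  have d1 := deriv_eq_of_eqOn hI hs (fun t ht => by rw [hT t ht]; rfl)
    (hsys.hasDerivAt_T s hs 1) (ha.hasDerivAt_sin (Real.sin ϑ) hs)
  have d2 := deriv_eq_of_eqOn hI hs (fun t ht => by rw [hT t ht]; rfl)
    (hsys.hasDerivAt_T s hs 2) (ha.hasDerivAt_cos (Real.sin ϑ) hs)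
  simp [hT s hs, conn] at d0 d1 d2
  ext i
  fin_cases i <;> simp
  · linear_combination d0
  · linear_combination d1
  · linear_combination d2

lemma covDeriv_tension_coef (hτ : τ ≠ 0) (hI : IsOpen I) (h : IsUnitSpeedCurve τ I γ)
    (hbi : IsProperBiharmonic τ I γ) (ha : HasAngleData τ I γ ϑ β b) {s : ℝ} (hs : s ∈ I) :
    coefAlong τ γ (covDeriv τ γ (tension τ γ)) s =
      ![-(τ * (b + 2 * (τ⁻¹ + τ) * Real.cos ϑ) * Real.sin ϑ ^ 2),
      -((b + (2 * τ⁻¹ + τ) * Real.cos ϑ) * (b + 2 * (τ⁻¹ + τ) * Real.cos ϑ) * Real.sin ϑ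
        * Real.sin (β s)),
      -((b + (2 * τ⁻¹ + τ) * Real.cos ϑ) * (b + 2 * (τ⁻¹ + τ) * Real.cos ϑ) * Real.sin ϑ
        * Real.cos (β s))] := by
  have hsys := frameSystem hτ hI h hbi.biharmonic
  have hT := ha.coefAlong_eq hτ h hs
  have hV := fun t (ht : t ∈ I) => ha.tension_coef hτ hI h hbi ht
  have d0 := deriv_eq_of_eqOn hI hs (fun t ht => by rw [hV t ht]; rfl)
    (hsys.hasDerivAt_V s hs 0) (hasDerivAt_const s 0)
  have d1 := deriv_eq_of_eqOn hI hs (fun t ht => by rw [hV t ht]; rfl)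
    (hsys.hasDerivAt_V s hs 1) (ha.hasDerivAt_cos _ hs)
  have d2 := deriv_eq_of_eqOn hI hs (fun t ht => by rw [hV t ht]; rfl)
    (hsys.hasDerivAt_V s hs 2) (ha.hasDerivAt_sin _ hs)
  simp [hT, hV s hs, conn] at d0 d1 d2
  have hsc := Real.sin_sq_add_cos_sq (β s)
  ext i
  fin_cases i <;> simp
  · linear_combination d0 - τ * (b + 2 * (τ⁻¹ + τ) * Real.cos ϑ) * Real.sin ϑ ^ 2 * hsc
  · linear_combination d1
  · linear_combination d2

lemma sin_pos (ha : HasAngleData τ I γ ϑ β b) : 0 < Real.sin ϑ :=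
  Real.sin_pos_of_pos_of_lt_pi ha.angle_mem.1
    (by linarith [ha.angle_mem.2, Real.pi_pos])

lemma cos_nonneg (ha : HasAngleData τ I γ ϑ β b) : 0 ≤ Real.cos ϑ :=
  Real.cos_nonneg_of_neg_pi_div_two_le_of_le (by linarith [ha.angle_mem.1, Real.pi_pos])
    ha.angle_mem.2

/-- The relation between the angle and the rotation speed of a proper biharmonic curve. -/
lemma speed_quadratic (hτ : τ ≠ 0) (hI : IsOpen I) (hc : I.OrdConnected)
    (h : IsUnitSpeedCurve τ I γ) (hbi : IsProperBiharmonic τ I γ)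
    (ha : HasAngleData τ I γ ϑ β b) {s : ℝ} (hs : s ∈ I) :
    (b + (2 * τ⁻¹ + τ) * Real.cos ϑ) ^ 2
      = (4 + 5 * τ ^ 2) * Real.cos ϑ ^ 2 - 4 * (1 + τ ^ 2) := by
  have hsys := frameSystem hτ hI h hbi.biharmonic
  have hT := ha.coefAlong_eq hτ h hs
  have hV := ha.tension_coef hτ hI h hbi hs
  have hU := ha.covDeriv_tension_coef hτ hI h hbi hs
  have hne := dot_tension_ne_zero hτ hI hc h hbi hs
  have hd := hsys.dot_U_U hτ hI hs
  rw [hT, hU, hV] at hd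
  rw [hV] at hne
  have hsc := Real.sin_sq_add_cos_sq (β s)
  have hS := Real.sin_sq_add_cos_sq ϑ
  set x := b + 2 * (τ⁻¹ + τ) * Real.cos ϑ with hx
  set y := b + (2 * τ⁻¹ + τ) * Real.cos ϑ with hy
  have hv : vert ![Real.cos ϑ, Real.sin ϑ * Real.sin (β s), Real.sin ϑ * Real.cos (β s)]
      ![0, x * Real.sin ϑ * Real.cos (β s), -(x * Real.sin ϑ) * Real.sin (β s)]
      = -(x * Real.sin ϑ ^ 2) := by
    simp [vert]
    linear_combination -(x * Real.sin ϑ ^ 2) * hsc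
  have hK : dot ![0, x * Real.sin ϑ * Real.cos (β s), -(x * Real.sin ϑ) * Real.sin (β s)]
      ![0, x * Real.sin ϑ * Real.cos (β s), -(x * Real.sin ϑ) * Real.sin (β s)]
      = x ^ 2 * Real.sin ϑ ^ 2 := by
    simp [dot]
    linear_combination (x ^ 2 * Real.sin ϑ ^ 2) * hsc
  rw [hv, hK] at hd
  rw [hK] at hne
  refine mul_left_cancel₀ hne ?_
  simp [dot] at hd
  linear_combination hd - x ^ 2 * y ^ 2 * Real.sin ϑ ^ 2 * hsc
    - x ^ 2 * Real.sin ϑ ^ 2 * (4 + 5 * τ ^ 2) * hS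

end HasAngleData

end Curve

/-! ### Scalars in the degenerate case -/

/-- The algebra of the case `b ^ 2 = 4 a`. -/
lemma scalars_of_sq_eq (hτ : 0 < τ) {ϑ b : ℝ} (hS : 0 < Real.sin ϑ) (hC : 0 ≤ Real.cos ϑ)
    (hq : (b + (2 * τ⁻¹ + τ) * Real.cos ϑ) ^ 2
      = (4 + 5 * τ ^ 2) * Real.cos ϑ ^ 2 - 4 * (1 + τ ^ 2))
    (hb : b ^ 2 = 4 * aConst τ ϑ b) :
    b = -(τ⁻¹ * (2 + τ ^ 2) * Real.cos ϑ)
        + Real.sqrt ((4 + 5 * τ ^ 2) * Real.cos ϑ ^ 2 - 4 * (1 + τ ^ 2)) ∧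
      Real.cos ϑ ^ 2 = (2 + τ ^ 2) ^ 2 / (4 + 5 * τ ^ 2 + τ ^ 4) ∧
      Real.sin ϑ = g14 τ ∧ b = -(2 * Real.sqrt (aConst τ ϑ b)) ∧
      -(τ⁻¹ * Real.cos ϑ) = g14 τ - Real.sqrt (aConst τ ϑ b) := by
  have hsc := Real.sin_sq_add_cos_sq ϑ
  set C := Real.cos ϑ
  set S := Real.sin ϑ
  have hi : τ⁻¹ * τ = 1 := inv_mul_cancel₀ hτ.ne'
  have hii : (τ ^ 2)⁻¹ = τ⁻¹ ^ 2 := (inv_pow τ 2).symm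
  -- Completing the square in b² = 4a: in terms of y it reads y² = 4 sin²ϑ.
  obtain ⟨y, rfl⟩ : ∃ y, b = y - 2 * τ⁻¹ * C := ⟨b + 2 * τ⁻¹ * C, by ring⟩
  have hy : y ^ 2 = 4 * S ^ 2 := by
    rw [aConst, Real.cos_two_mul, hii] at hb
    linear_combination hb - 4 * hsc
  have hprod : y * ((2 + τ ^ 2) * y + 2 * τ * C) = 0 := by
    linear_combination hq + (1 + τ ^ 2) * hy + 4 * (1 + τ ^ 2) * hsc
  have hy0 : y ≠ 0 := by
    rintro rfl
    nlinarith
  have hyC : (2 + τ ^ 2) * y + 2 * τ * C = 0 := (mul_eq_zero.1 hprod).resolve_left hy0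
  have hpos : 0 < 4 + 5 * τ ^ 2 + τ ^ 4 := by positivity
  have h2 : 0 < 2 + τ ^ 2 := by positivity
  -- The orientation, cos ϑ ≥ 0, selects the root y = -2 sin ϑ.
  have hyle : y ≤ 0 := by nlinarith [mul_nonneg hτ.le hC]
  have hyS : y = -(2 * S) := by nlinarith
  have hCS : τ * C = (2 + τ ^ 2) * S := by
    rw [hyS] at hyC
    linarith
  have hC2 : (4 + 5 * τ ^ 2 + τ ^ 4) * C ^ 2 = (2 + τ ^ 2) ^ 2 := by
    linear_combination (2 + τ ^ 2) ^ 2 * hsc + (τ * C + (2 + τ ^ 2) * S) * hCS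
  have hS2 : S ^ 2 * (4 + 5 * τ ^ 2 + τ ^ 4) = τ ^ 2 := by
    linear_combination (4 + 5 * τ ^ 2 + τ ^ 4) * hsc - hC2
  have hg : S = g14 τ := by
    rw [g14, eq_div_iff (Real.sqrt_pos.2 hpos).ne', ← Real.sqrt_sq hS.le, ← Real.sqrt_mul
      (sq_nonneg S), hS2, Real.sqrt_sq hτ.le]
  have hr : Real.sqrt (aConst τ ϑ (y - 2 * τ⁻¹ * C)) = S + τ⁻¹ * C := by
    rw [Real.sqrt_eq_iff_mul_self_eq_of_pos (by positivity)]
    rw [hyS] at hb ⊢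
    linear_combination hb / 4
  refine ⟨?_, ?_, hg, ?_, ?_⟩
  · have hnn : 0 ≤ y - 2 * τ⁻¹ * C + (2 * τ⁻¹ + τ) * C := by
      rw [hyS]
      nlinarith [mul_pos (pow_pos hτ 2) hS]
    rw [← hq, Real.sqrt_sq hnn]
    linear_combination τ * C * hi
  · rw [eq_div_iff hpos.ne']
    linear_combination hC2
  · rw [hr, hyS]
    ring
  · rw [hr, hg]
    ring

/-! ### Isometries commuting with J₁ and congruence with the model curve -/

lemma mem_O24_of_transpose_mul {A : Matrix (Fin 4) (Fin 4) ℝ} (hA : Aᵀ * eps * A = eps) :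
    A ∈ O24 := by
  have he : eps * eps = 1 := by
    rw [eps, Matrix.diagonal_mul_diagonal, ← Matrix.diagonal_one]
    congr 1
    ext i
    fin_cases i <;> simp
  have hl : (eps * Aᵀ * eps) * A = 1 := by
    rw [mul_assoc, mul_assoc, ← mul_assoc Aᵀ, hA, he]
  have hinv : A⁻¹ = eps * Aᵀ * eps := Matrix.inv_eq_left_inv hl
  refine ⟨⟨⟨A, _, mul_eq_one_comm.1 hl, hl⟩, rfl⟩, ?_⟩
  rw [hinv]
  simp only [mul_assoc, he, mul_one]
  rw [← mul_assoc, he, one_mul]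

/-- Multiplication by `c + i d` on `ℂ²`. -/
def phaseMat (c d : ℝ) : Matrix (Fin 4) (Fin 4) ℝ :=
  !![c, -d, 0, 0; d, c, 0, 0; 0, 0, c, -d; 0, 0, d, c]

/-- The matrix `[[P, Q], [Q̄, P̄]]` of `SU(1, 1)`, with `P = p + i p'` and `Q = q + i q'`. -/
def suMat (p p' q q' : ℝ) : Matrix (Fin 4) (Fin 4) ℝ :=
  !![p, -p', q, -q'; p', p, q', q; q, q', p, p'; -q', q, -p', p]

lemma phaseMat_transpose_mul {c d : ℝ} (h : c ^ 2 + d ^ 2 = 1) :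
    (phaseMat c d)ᵀ * eps * phaseMat c d = eps := by
  ext i j
  fin_cases i <;> fin_cases j <;>
    simp [phaseMat, eps, Matrix.mul_apply, Fin.sum_univ_four, Matrix.diagonal_apply] <;>
    linarith

lemma suMat_transpose_mul {p p' q q' : ℝ} (h : p ^ 2 + p' ^ 2 - q ^ 2 - q' ^ 2 = 1) :
    (suMat p p' q q')ᵀ * eps * suMat p p' q q' = eps := by
  ext i j
  fin_cases i <;> fin_cases j <;>
    simp [suMat, eps, Matrix.mul_apply, Fin.sum_univ_four, Matrix.diagonal_apply] <;>
    linarith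

lemma phaseMat_mul_J1 (c d : ℝ) : phaseMat c d * J1 = J1 * phaseMat c d := by
  ext i j
  fin_cases i <;> fin_cases j <;> simp [phaseMat, J1, Matrix.mul_apply, Fin.sum_univ_four]

lemma suMat_mul_J1 (p p' q q' : ℝ) : suMat p p' q q' * J1 = J1 * suMat p p' q q' := by
  ext i j
  fin_cases i <;> fin_cases j <;> simp [suMat, J1, Matrix.mul_apply, Fin.sum_univ_four]

/-- The velocity `α X₁ + μ X₂ + ν X₃`. -/
def velocity (α μ ν : ℝ) (v : R42) : R42 := α • X1 v + μ • X2 v + ν • X3 v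

/-- Two curves in `SL(2, ℝ)` with the same coefficients of velocity differ by a left
translation. -/
lemma exists_suMat {I : Set ℝ} (hI : IsOpen I) (hc : I.OrdConnected) {v m : ℝ → R42}
    {α : ℝ} {μ ν : ℝ → ℝ} (hne : I.Nonempty)
    (hv : ∀ s ∈ I, HasDerivAt v (velocity α (μ s) (ν s) (v s)) s)
    (hm : ∀ s ∈ I, HasDerivAt m (velocity α (μ s) (ν s) (m s)) s)
    (hvm : ∀ s ∈ I, v s ∈ SL2) (hmm : ∀ s ∈ I, m s ∈ SL2) :
    ∃ p p' q q' : ℝ, p ^ 2 + p' ^ 2 - q ^ 2 - q' ^ 2 = 1 ∧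
      ∀ s ∈ I, v s = (suMat p p' q q').mulVec (m s) := by
  obtain ⟨s₀, hs₀⟩ := hne
  have dv := fun s hs => hasDerivAt_pi.1 (hv s hs)
  have dm := fun s hs => hasDerivAt_pi.1 (hm s hs)
  have key : ∀ F : ℝ → ℝ, (∀ s ∈ I, HasDerivAt F 0 s) → ∀ s ∈ I, F s = F s₀ :=
    fun F hF s hs => eq_of_hasDerivAt_zero hI hc hF hs hs₀
  -- Writing (z, w) as the matrix [[z, w̄], [w, z̄]], the four first integrals are the real and
  -- imaginary parts of the entries P and Q of v m⁻¹.
  have hp := key (fun s => v s 0 * m s 0 + v s 1 * m s 1 - v s 2 * m s 2 - v s 3 * m s 3)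
    fun s hs => (((((dv s hs 0).fun_mul (dm s hs 0)).fun_add
      ((dv s hs 1).fun_mul (dm s hs 1))).fun_sub ((dv s hs 2).fun_mul (dm s hs 2))).fun_sub
      ((dv s hs 3).fun_mul (dm s hs 3))).congr_deriv (by
        simp [velocity, X1, X2, X3]; ring)
  have hp' := key (fun s => v s 1 * m s 0 - v s 0 * m s 1 - v s 2 * m s 3 + v s 3 * m s 2)
    fun s hs => (((((dv s hs 1).fun_mul (dm s hs 0)).fun_sub
      ((dv s hs 0).fun_mul (dm s hs 1))).fun_sub ((dv s hs 2).fun_mul (dm s hs 3))).fun_add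
      ((dv s hs 3).fun_mul (dm s hs 2))).congr_deriv (by
        simp [velocity, X1, X2, X3]; ring)
  have hq := key (fun s => v s 2 * m s 0 + v s 3 * m s 1 - v s 0 * m s 2 - v s 1 * m s 3)
    fun s hs => (((((dv s hs 2).fun_mul (dm s hs 0)).fun_add
      ((dv s hs 3).fun_mul (dm s hs 1))).fun_sub ((dv s hs 0).fun_mul (dm s hs 2))).fun_sub
      ((dv s hs 1).fun_mul (dm s hs 3))).congr_deriv (by
        simp [velocity, X1, X2, X3]; ring)
  have hq' := key (fun s => v s 2 * m s 1 - v s 3 * m s 0 - v s 1 * m s 2 + v s 0 * m s 3)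
    fun s hs => (((((dv s hs 2).fun_mul (dm s hs 1)).fun_sub
      ((dv s hs 3).fun_mul (dm s hs 0))).fun_sub ((dv s hs 1).fun_mul (dm s hs 2))).fun_add
      ((dv s hs 0).fun_mul (dm s hs 3))).congr_deriv (by
        simp [velocity, X1, X2, X3]; ring)
  refine ⟨v s₀ 0 * m s₀ 0 + v s₀ 1 * m s₀ 1 - v s₀ 2 * m s₀ 2 - v s₀ 3 * m s₀ 3,
    v s₀ 1 * m s₀ 0 - v s₀ 0 * m s₀ 1 - v s₀ 2 * m s₀ 3 + v s₀ 3 * m s₀ 2,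
    v s₀ 2 * m s₀ 0 + v s₀ 3 * m s₀ 1 - v s₀ 0 * m s₀ 2 - v s₀ 1 * m s₀ 3,
    v s₀ 2 * m s₀ 1 - v s₀ 3 * m s₀ 0 - v s₀ 1 * m s₀ 2 + v s₀ 0 * m s₀ 3, ?_, fun s hs => ?_⟩
  rotate_left
  · have h1 : m s 0 * m s 0 + m s 1 * m s 1 - m s 2 * m s 2 - m s 3 * m s 3 = 1 := hmm s hs
    rw [← hp s hs, ← hp' s hs, ← hq s hs, ← hq' s hs]
    ext i
    fin_cases i <;> simp [suMat, Matrix.mulVec, dotProduct, Fin.sum_univ_four]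
    · linear_combination -(v s 0) * h1
    · linear_combination -(v s 1) * h1
    · linear_combination -(v s 2) * h1
    · linear_combination -(v s 3) * h1
  · have h1 : m s₀ 0 * m s₀ 0 + m s₀ 1 * m s₀ 1 - m s₀ 2 * m s₀ 2 - m s₀ 3 * m s₀ 3 = 1 :=
      hmm s₀ hs₀
    have h2 : v s₀ 0 * v s₀ 0 + v s₀ 1 * v s₀ 1 - v s₀ 2 * v s₀ 2 - v s₀ 3 * v s₀ 3 = 1 :=
      hvm s₀ hs₀
    linear_combination (v s₀ 0 * v s₀ 0 + v s₀ 1 * v s₀ 1 - v s₀ 2 * v s₀ 2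
      - v s₀ 3 * v s₀ 3) * h1 + h2

lemma modelCurve_mem (r g s : ℝ) : modelCurve r g s ∈ SL2 := by
  simp [SL2, modelCurve, pinner]
  linear_combination Real.sin_sq_add_cos_sq (r * s)

lemma hasDerivAt_modelCurve (r g s : ℝ) : HasDerivAt (modelCurve r g)
    (velocity (g - r) (g * Real.sin (2 * (r * s))) (-(g * Real.cos (2 * (r * s))))
      (modelCurve r g s)) s := by
  have hsin : HasDerivAt (fun t => Real.sin (r * t)) (Real.cos (r * s) * r) s := by
    simpa using ((hasDerivAt_id s).const_mul r).sin
  have hcos : HasDerivAt (fun t => Real.cos (r * t)) (-Real.sin (r * s) * r) s := by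
    simpa using ((hasDerivAt_id s).const_mul r).cos
  have hg : HasDerivAt (fun t => g * t) g s := by
    simpa using (hasDerivAt_id s).const_mul g
  have hsc := Real.sin_sq_add_cos_sq (r * s)
  rw [hasDerivAt_pi]
  intro i
  fin_cases i
  · refine (hcos.fun_add (hg.fun_mul hsin)).congr_deriv ?_
    simp [velocity, X1, X2, X3, modelCurve, Real.sin_two_mul, Real.cos_two_mul']
    linear_combination -(g ^ 2 * s * Real.cos (r * s)) * hsc
  · refine (hsin.fun_neg.fun_add (hg.fun_mul hcos)).congr_deriv ?_
    simp [velocity, X1, X2, X3, modelCurve, Real.sin_two_mul, Real.cos_two_mul']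
    linear_combination (g ^ 2 * s * Real.sin (r * s)) * hsc
  · refine (hg.fun_mul hcos).fun_neg.congr_deriv ?_
    simp [velocity, X1, X2, X3, modelCurve, Real.sin_two_mul, Real.cos_two_mul']
    linear_combination (g * Real.cos (r * s) - g ^ 2 * s * Real.sin (r * s)) * hsc
  · refine (hg.fun_mul hsin).congr_deriv ?_
    simp [velocity, X1, X2, X3, modelCurve, Real.sin_two_mul, Real.cos_two_mul']
    linear_combination -(g * Real.sin (r * s) + g ^ 2 * s * Real.cos (r * s)) * hsc

/-- A phase change of a curve rotates the horizontal part of its velocity by twice the phase. -/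
lemma hasDerivAt_phaseMat {v : ℝ → R42} {α g β s : ℝ} (ψ : ℝ)
    (hv : HasDerivAt v (velocity α (g * Real.sin β) (g * Real.cos β) (v s)) s) :
    HasDerivAt (fun t => (phaseMat (Real.cos ψ) (Real.sin ψ)).mulVec (v t))
      (velocity α (g * Real.sin (β + 2 * ψ)) (g * Real.cos (β + 2 * ψ))
        ((phaseMat (Real.cos ψ) (Real.sin ψ)).mulVec (v s))) s := by
  have h : HasDerivAt (fun t => (phaseMat (Real.cos ψ) (Real.sin ψ)).mulVec (v t)) _ s :=
    (LinearMap.toContinuousLinearMap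
      (Matrix.mulVecLin (phaseMat (Real.cos ψ) (Real.sin ψ)))).hasFDerivAt.comp_hasDerivAt s hv
  refine h.congr_deriv ?_
  have hsc := Real.sin_sq_add_cos_sq ψ
  have hs3 : Real.sin (β + 2 * ψ) * Real.cos ψ - Real.cos (β + 2 * ψ) * Real.sin ψ
      = Real.sin β * Real.cos ψ + Real.cos β * Real.sin ψ := by
    rw [← Real.sin_sub, ← Real.sin_add]
    ring_nf
  have hc3 : Real.cos (β + 2 * ψ) * Real.cos ψ + Real.sin (β + 2 * ψ) * Real.sin ψ
      = Real.cos β * Real.cos ψ - Real.sin β * Real.sin ψ := by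
    rw [← Real.cos_sub, ← Real.cos_add]
    ring_nf
  ext i
  fin_cases i <;>
    simp [velocity, X1, X2, X3, phaseMat, Matrix.mulVec, dotProduct, Fin.sum_univ_four]
  · linear_combination -(g * v s 3) * hs3 - g * v s 2 * hc3
  · linear_combination -(g * v s 2) * hs3 + g * v s 3 * hc3
  · linear_combination -(g * v s 1) * hs3 - g * v s 0 * hc3
  · linear_combination -(g * v s 0) * hs3 + g * v s 1 * hc3

lemma phaseMat_mulVec_mem {c d : ℝ} (h : c ^ 2 + d ^ 2 = 1) {v : R42} (hv : v ∈ SL2) :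
    (phaseMat c d).mulVec v ∈ SL2 := by
  have h1 : v 0 * v 0 + v 1 * v 1 - v 2 * v 2 - v 3 * v 3 = 1 := hv
  simp [SL2, pinner, phaseMat, dotProduct, Fin.sum_univ_four]
  linear_combination (c ^ 2 + d ^ 2) * h1 + h

lemma phaseMat_neg_mulVec {c d : ℝ} (h : c ^ 2 + d ^ 2 = 1) (v : R42) :
    (phaseMat c (-d)).mulVec ((phaseMat c d).mulVec v) = v := by
  ext i
  fin_cases i <;> simp [phaseMat, Matrix.mulVec, dotProduct, Fin.sum_univ_four]
  · linear_combination v 0 * h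
  · linear_combination v 1 * h
  · linear_combination v 2 * h
  · linear_combination v 3 * h

/-- A curve whose velocity has the coefficients of the model curve up to a phase is congruent to
the model curve. -/
lemma exists_congruence {I : Set ℝ} (hI : IsOpen I) (hc : I.OrdConnected) (hne : I.Nonempty)
    {γ : ℝ → R42} {r g φ : ℝ} (hγ : ∀ s ∈ I, γ s ∈ SL2)
    (hd : ∀ s ∈ I, HasDerivAt γ (velocity (g - r) (g * Real.sin (-(2 * r) * s + φ))
      (g * Real.cos (-(2 * r) * s + φ)) (γ s)) s) :
    ∃ A ∈ O24, A * J1 = J1 * A ∧ ∀ s ∈ I, γ s = A.mulVec (modelCurve r g s) := by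
  -- The velocity of the model curve has phase π - 2rs, so the phase -2rs + φ must be shifted by 2ψ
  -- = π - φ.
  set ψ := (Real.pi - φ) / 2 with hψ
  have hcs : Real.cos ψ ^ 2 + Real.sin ψ ^ 2 = 1 := by
    rw [add_comm]
    exact Real.sin_sq_add_cos_sq ψ
  have hph : ∀ s, -(2 * r) * s + φ + 2 * ψ = Real.pi - 2 * (r * s) := fun s => by
    rw [hψ]
    ring
  obtain ⟨p, p', q, q', h1, h2⟩ := exists_suMat hI hc hne
    (v := fun t => (phaseMat (Real.cos ψ) (Real.sin ψ)).mulVec (γ t)) (m := modelCurve r g)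
    (fun s hs => by
      have := hasDerivAt_phaseMat ψ (hd s hs)
      rwa [hph, Real.sin_pi_sub, Real.cos_pi_sub, mul_neg] at this)
    (fun s _ => hasDerivAt_modelCurve r g s)
    (fun s hs => phaseMat_mulVec_mem hcs (hγ s hs)) (fun s _ => modelCurve_mem r g s)
  have h3 := phaseMat_transpose_mul (c := Real.cos ψ) (d := -Real.sin ψ) (by rwa [neg_sq])
  refine ⟨phaseMat (Real.cos ψ) (-Real.sin ψ) * suMat p p' q q',
    mem_O24_of_transpose_mul ?_, ?_, fun s hs => ?_⟩
  · rw [Matrix.transpose_mul, mul_assoc (suMat p p' q q')ᵀ, mul_assoc (suMat p p' q q')ᵀ,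
      ← mul_assoc _ (phaseMat _ _), h3, ← mul_assoc, suMat_transpose_mul h1]
  · rw [mul_assoc, suMat_mul_J1, ← mul_assoc, phaseMat_mul_J1, mul_assoc]
  · rw [← Matrix.mulVec_mulVec, ← h2 s hs, phaseMat_neg_mulVec hcs]

end SLtau

end

/-! ### The main theorem -/

theorem mainTheorem5 (τ : ℝ) (hτ : 0 < τ) (I : Set ℝ) (hIopen : IsOpen I)
    (hIconn : I.OrdConnected) (γ : ℝ → SLtau.R42)
    (hγ : SLtau.IsUnitSpeedCurve τ I γ) (hbi : SLtau.IsProperBiharmonic τ I γ)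
    (horient : ∀ s ∈ I, 0 ≤ SLtau.metric τ (γ s) (deriv γ s) (SLtau.frame τ 0 (γ s))) :
    (∃ (ϑ : ℝ) (β : ℝ → ℝ) (b : ℝ), SLtau.HasAngleData τ I γ ϑ β b) ∧
    ∀ (ϑ : ℝ) (β : ℝ → ℝ) (b : ℝ), SLtau.HasAngleData τ I γ ϑ β b →
      b ^ 2 = 4 * SLtau.aConst τ ϑ b →
        b = -(τ⁻¹ * (2 + τ ^ 2) * Real.cos ϑ)
            + Real.sqrt ((4 + 5 * τ ^ 2) * Real.cos ϑ ^ 2 - 4 * (1 + τ ^ 2)) ∧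
        Real.cos ϑ ^ 2 = (2 + τ ^ 2) ^ 2 / (4 + 5 * τ ^ 2 + τ ^ 4) ∧
        ∃ A ∈ SLtau.O24, A * SLtau.J1 = SLtau.J1 * A ∧
          ∀ s ∈ I, γ s =
            A.mulVec (SLtau.modelCurve (Real.sqrt (SLtau.aConst τ ϑ b)) (SLtau.g14 τ) s) := by
  refine ⟨SLtau.exists_angleData hτ.ne' hIopen hIconn hγ hbi horient, ?_⟩
  intro ϑ β b ha hb
  obtain ⟨s₀, hs₀⟩ : I.Nonempty := by
    by_contra hne
    rw [Set.not_nonempty_iff_eq_empty] at hne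
    exact hbi.not_geodesic (by simp [hne])
  obtain ⟨h1, h2, hS, hr, hα⟩ := SLtau.scalars_of_sq_eq hτ ha.sin_pos ha.cos_nonneg
    (ha.speed_quadratic hτ.ne' hIopen hIconn hγ hbi hs₀) hb
  refine ⟨h1, h2, ?_⟩
  set r := Real.sqrt (SLtau.aConst τ ϑ b)
  -- β is affine with slope b = -2√a, exactly the rotation speed of the model curve.
  have hβ : ∀ s ∈ I, β s = -(2 * r) * s + (β s₀ + 2 * r * s₀) := fun s hs => by
    have := SLtau.eq_of_hasDerivAt_zero hIopen hIconn (f := fun t => β t - b * t)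
      (fun t ht => ((ha.hasDerivAt t ht).fun_sub
        ((hasDerivAt_id' t).const_mul b)).congr_deriv (by ring)) hs hs₀
    rw [hr] at this
    linear_combination this
  refine SLtau.exists_congruence hIopen hIconn ⟨s₀, hs₀⟩ (φ := β s₀ + 2 * r * s₀) hγ.mem
    fun s hs => ?_
  have hd := hγ.hasDerivAt hIopen hs
  rw [ha.tangent s hs] at hd
  refine hd.congr_deriv ?_
  rw [← hβ s hs, ← hS]
  rw [← hS] at hα
  simp only [SLtau.velocity, ← hα, SLtau.frame, smul_smul]
  congr 3
  ring
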